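/- **Corollary (Comparison of PEPS error bounds).** Work over $\mathbb K=\mathbb R$ or $\mathbb C$ and let $m,n,D\ge 1$. An $m\times n$ PEPS $\mathcal T$ consists of site tensors $T^{(i,j)}$ ($1\le i\le m$, $1\le j\le n$), each with one physical leg and one bond to each of its nearest neighbours in the rectangular lattice. Contracting the vertical bonds of column $j$ gives the column tensor $T^{(\cdot,j)}$, and contracting all column tensors along the horizontal bonds gives the represented tensor $\mathbf T$. $\|\cdot\|_F$ is the Frobenius norm. *Perturbations.* For $\epsilon_1,\epsilon_2\ge 0$, an $(\epsilon_1,\epsilon_2)$-perturbation $(\Delta,\delta)$ of $\mathcal T$ consists of tensors $\Delta^{(j)}$ ($1\le j\le n-1$) of the shape of $T^{(\cdot,j)}$ with $\|\Delta^{(j)}\|_F\le\epsilon_1\|T^{(\cdot,j)}\|_F$, and tensors $\delta^{(i)}$ ($1\le i\le m$) of the shape of $T^{(i,n)}$ with $\|\delta^{(i)}\|_F\le\epsilon_2\|T^{(i,n)}\|_F$. Let $\hat{\mathbf T}$ be the tensor obtained by replacing the column tensors $T^{(\cdot,j)}$ by $T^{(\cdot,j)}+\Delta^{(j)}$ for $j\le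 n-1$ and the sites $T^{(i,n)}$ of the last (center) column by $T^{(i,n)}+\delta^{(i)}$. When $\mathbf T\ne0$, put $$\mathscr E_r(\mathcal T,\Delta,\delta)=\frac{\|\hat{\mathbf T}-\mathbf T\|_F}{\|\mathbf T\|_F},\qquad E_{\mathcal T}(\epsilon_1,\epsilon_2)=\sup_{\Delta,\delta}\mathscr E_r(\mathcal T,\Delta,\delta),$$ the supremum being over all $(\epsilon_1,\epsilon_2)$-perturbations of $\mathcal T$. *Canonical form.* A PEPS $\mathcal C$ is canonical (columnwise, centered at the lower right corner) if each column tensor $C^{(\cdot,j)}$, $j\le n-1$, is an isometry from its right legs to its left and physical legs, and each site $C^{(i,n)}$, $i\le m-1$, is an isometry from its lower leg to its remaining legs. A canonical form of $\mathcal T$ is a canonical PEPS with the same lattice and physical legs that represents the same tensor $\mathbf T$. For $\epsilon_1,\epsilon_2\ge0$ with $\epsilon_1(n-1)+\epsilon_2m>0$ put $$\Phi(\epsilon_1,\epsilon_2)=\frac{\epsilon_1\,(n-1)D^{m/2}+\epsilon_2\bigl(1+(m-1)\sqrt D\bigr)}{\epsilon_1(n-1)+\epsilon_2m}.$$ 1.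 There is a constant $K$, depending only on $m,n,D$ (and $\mathbb K$), such that for every $m\times n$ PEPS $\mathcal T$ with $\mathbf T\neq0$, every canonical form $\mathcal C$ of $\mathcal T$ all of whose bond dimensions are at most $D$, and all $\epsilon_1,\epsilon_2\in[0,1]$ with $\epsilon_1(n-1)+\epsilon_2m>0$, both suprema are finite and $$E_{\mathcal C}(\epsilon_1,\epsilon_2)\le\Phi(\epsilon_1,\epsilon_2)\,E_{\mathcal T}(\epsilon_1,\epsilon_2)+K(\epsilon_1^2+\epsilon_2^2).$$ 2. The factor $\Phi$ cannot be improved, even if all bonds have dimension exactly $D$ and the tensors of $\mathcal T$ have full rank: for every $d\ge D$ and every $\eta>0$ there are an $m\times n$ PEPS $\mathcal T$ with $\mathbf T\ne0$ and a canonical form $\mathcal C$ of $\mathcal T$, both with all bond dimensions equal to $D$ and all physical dimensions equal to $d$, such that the following matricizations have linearly independent columns: $T^{(\cdot,j)}$ for $j\le n-1$ (columns indexed by the right legs), $T^{(i,n)}$ for $i\le m-1$ (columns indexed by the lower leg), and $T^{(m,n)}$ (columns indexed by the upper leg); and such that for some constant $K$, for all $\epsilon_1,\epsilon_2\in[0,1]$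 with $\epsilon_1(n-1)+\epsilon_2m>0$, $$(1-\eta)\,\Phi(\epsilon_1,\epsilon_2)\,E_{\mathcal T}(\epsilon_1,\epsilon_2)\le E_{\mathcal C}(\epsilon_1,\epsilon_2)+K(\epsilon_1^2+\epsilon_2^2).$$ -/

import Mathlib

/-- The Frobenius (Hilbert-Schmidt) norm of a tensor with index set `ι`. -/
noncomputable def frobNorm {𝕜 ι : Type*} [RCLike 𝕜] [Fintype ι] (f : ι → 𝕜) : ℝ :=
  ‖(WithLp.toLp 2 f : EuclideanSpace 𝕜 ι)‖

/-- An `m × n` PEPS over `𝕜` with open boundary, whose physical leg at row `i`, column `j` has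
dimension `d i j`. The bond between the sites `(i, j)` and `(i, j + 1)` has dimension
`hbond i (j + 1)`, the one between `(i, j)` and `(i + 1, j)` has dimension `vbond (i + 1) j`.
Sites on the boundary of the lattice carry legs of dimension one pointing outwards, which is the
same as having no leg there. The arguments of `site i j` are the left, right, upper, lower and
physical index, in this order. -/
structure PEPS (𝕜 : Type*) (m n : ℕ) (d : Fin m → Fin n → ℕ) where
  hbond : Fin m → Fin (n + 1) → ℕ
  vbond : Fin (m + 1) → Fin n → ℕ
  hbond_left : ∀ i, hbond i 0 = 1
  hbond_right : ∀ i, hbond i (Fin.last n) = 1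
  vbond_top : ∀ j, vbond 0 j = 1
  vbond_bottom : ∀ j, vbond (Fin.last m) j = 1
  site : ∀ (i : Fin m) (j : Fin n),
    Fin (hbond i j.castSucc) × Fin (hbond i j.succ) ×
      Fin (vbond i.castSucc j) × Fin (vbond i.succ j) × Fin (d i j) → 𝕜

namespace PEPS

variable {𝕜 : Type*} {m n : ℕ} {d : Fin m → Fin n → ℕ}

/-- Indices of the site tensor at `(i, j)`: left, right, upper, lower, physical. -/
abbrev SiteIdx (T : PEPS 𝕜 m n d) (i : Fin m) (j : Fin n) : Type :=
  Fin (T.hbond i j.castSucc) × Fin (T.hbond i j.succ) ×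
    Fin (T.vbond i.castSucc j) × Fin (T.vbond i.succ j) × Fin (d i j)

/-- The joint index of the horizontal bonds of all rows at the vertical cut number `j`
(the cut number `j + 1` separates column `j` from column `j + 1`). -/
abbrev CutIdx (T : PEPS 𝕜 m n d) (j : Fin (n + 1)) : Type :=
  ∀ i : Fin m, Fin (T.hbond i j)

/-- Indices of the tensor of column `j`: all left, all right and all physical legs. -/
abbrev ColIdx (T : PEPS 𝕜 m n d) (j : Fin n) : Type :=
  T.CutIdx j.castSucc × T.CutIdx j.succ × (∀ i : Fin m, Fin (d i j))

variable [RCLike 𝕜]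

/-- The tensor obtained from arbitrary tensors `A i` on the sites of column `j` by contracting the
vertical bonds of that column. -/
def contractCol (T : PEPS 𝕜 m n d) (j : Fin n) (A : ∀ i, T.SiteIdx i j → 𝕜) (x : T.ColIdx j) : 𝕜 :=
  ∑ v : (∀ i : Fin (m + 1), Fin (T.vbond i j)),
    ∏ i : Fin m, A i (x.1 i, x.2.1 i, v i.castSucc, v i.succ, x.2.2 i)

/-- The tensor of column `j` of the PEPS. -/
def col (T : PEPS 𝕜 m n d) (j : Fin n) : T.ColIdx j → 𝕜 :=
  T.contractCol j (fun i => T.site i j)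

/-- The tensor obtained from arbitrary column tensors `B j` by contracting all horizontal bonds. -/
def contractRows (T : PEPS 𝕜 m n d) (B : ∀ j, T.ColIdx j → 𝕜) (p : ∀ i j, Fin (d i j)) : 𝕜 :=
  ∑ h : (∀ j : Fin (n + 1), T.CutIdx j),
    ∏ j : Fin n, B j (h j.castSucc, h j.succ, fun i => p i j)

/-- The tensor represented by the PEPS. -/
def tensor (T : PEPS 𝕜 m n d) : (∀ i j, Fin (d i j)) → 𝕜 :=
  T.contractRows T.col

/-- The represented tensor is the sum, over all bond indices, of the product of all site entries. -/
theorem tensor_eq_sum (T : PEPS 𝕜 m n d) (p : ∀ i j, Fin (d i j)) :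
    T.tensor p = ∑ h : (∀ j : Fin (n + 1), T.CutIdx j),
      ∑ v : (∀ (j : Fin n) (i : Fin (m + 1)), Fin (T.vbond i j)),
        ∏ j : Fin n, ∏ i : Fin m,
          T.site i j (h j.castSucc i, h j.succ i, v j i.castSucc, v j i.succ, p i j) := by
  unfold tensor contractRows col contractCol
  refine Finset.sum_congr rfl fun h _ => ?_
  rw [Finset.prod_univ_sum, Fintype.piFinset_univ]

/-- Column `j` as a matrix: columns are indexed by the right-going legs, rows by the left-going and
the physical legs. -/
def colMat (T : PEPS 𝕜 m n d) (j : Fin n) :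
    Matrix (T.CutIdx j.castSucc × (∀ i : Fin m, Fin (d i j))) (T.CutIdx j.succ) 𝕜 :=
  Matrix.of fun x r => T.col j (x.1, r, x.2)

/-- Site `(i, j)` as a matrix: columns are indexed by the down-going leg, rows by all others
(left, right, upper, physical). -/
def siteMatDown (T : PEPS 𝕜 m n d) (i : Fin m) (j : Fin n) :
    Matrix (Fin (T.hbond i j.castSucc) × Fin (T.hbond i j.succ) ×
      Fin (T.vbond i.castSucc j) × Fin (d i j)) (Fin (T.vbond i.succ j)) 𝕜 :=
  Matrix.of fun x b => T.site i j (x.1, x.2.1, x.2.2.1, b, x.2.2.2)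

/-- Site `(i, j)` as a matrix: columns are indexed by the up-going leg, rows by all others
(left, right, lower, physical). -/
def siteMatUp (T : PEPS 𝕜 m n d) (i : Fin m) (j : Fin n) :
    Matrix (Fin (T.hbond i j.castSucc) × Fin (T.hbond i j.succ) ×
      Fin (T.vbond i.succ j) × Fin (d i j)) (Fin (T.vbond i.castSucc j)) 𝕜 :=
  Matrix.of fun x a => T.site i j (x.1, x.2.1, a, x.2.2.1, x.2.2.2)

/-- (Columnwise) canonical form centered at the lower right corner: every column but the last
is an isometry from its right legs to its left and physical legs, and in the last column every site
but the last is an isometry from its lower leg to its other legs. -/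
def IsCanonical (T : PEPS 𝕜 m n d) : Prop :=
  (∀ j : Fin n, (j : ℕ) + 1 < n → (T.colMat j).conjTranspose * T.colMat j = 1) ∧
  (∀ (i : Fin m) (j : Fin n), (i : ℕ) + 1 < m → (j : ℕ) + 1 = n →
    (T.siteMatDown i j).conjTranspose * T.siteMatDown i j = 1)

/-- The non-center columns and all sites of the center column have matricizations of full column
rank, in the orientation of the canonicalization (for the corner site, with respect to
its upper leg). -/
def HasFullRank (T : PEPS 𝕜 m n d) : Prop :=
  (∀ j : Fin n, (j : ℕ) + 1 < n → LinearIndependent 𝕜 (T.colMat j).col) ∧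
  (∀ (i : Fin m) (j : Fin n), (i : ℕ) + 1 < m → (j : ℕ) + 1 = n →
    LinearIndependent 𝕜 (T.siteMatDown i j).col) ∧
  (∀ (i : Fin m) (j : Fin n), (i : ℕ) + 1 = m → (j : ℕ) + 1 = n →
    LinearIndependent 𝕜 (T.siteMatUp i j).col)

/-- All bond dimensions are at most `D`. -/
def BondsLE (T : PEPS 𝕜 m n d) (D : ℕ) : Prop :=
  (∀ i j, T.hbond i j ≤ D) ∧ (∀ i j, T.vbond i j ≤ D)

/-- All bonds between neighbouring sites have dimension exactly `D`. -/
def BondsEq (T : PEPS 𝕜 m n d) (D : ℕ) : Prop :=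
  (∀ i j, j ≠ 0 → j ≠ Fin.last n → T.hbond i j = D) ∧
  (∀ i j, i ≠ 0 → i ≠ Fin.last m → T.vbond i j = D)

/-- The tensor of the PEPS perturbed by `(Δ, δ)`: the tensor `Δ j` is added to the tensor of each
column `j` but the last, and `δ i j` is added to each site `(i, j)` of the last column `j`.
(The other components of `Δ` and `δ` are not used.) -/
def perturbedTensor (T : PEPS 𝕜 m n d) (Δ : ∀ j, T.ColIdx j → 𝕜)
    (δ : ∀ i j, T.SiteIdx i j → 𝕜) : (∀ i j, Fin (d i j)) → 𝕜 :=
  T.contractRows fun j =>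
    if (j : ℕ) + 1 < n then T.col j + Δ j
    else T.contractCol j fun i => T.site i j + δ i j

/-- `(Δ, δ)` is an `(ε₁, ε₂)`-perturbation. -/
def IsPerturbation (T : PEPS 𝕜 m n d) (ε₁ ε₂ : ℝ) (Δ : ∀ j, T.ColIdx j → 𝕜)
    (δ : ∀ i j, T.SiteIdx i j → 𝕜) : Prop :=
  (∀ j : Fin n, (j : ℕ) + 1 < n → frobNorm (Δ j) ≤ ε₁ * frobNorm (T.col j)) ∧
  (∀ (i : Fin m) (j : Fin n), (j : ℕ) + 1 = n →
    frobNorm (δ i j) ≤ ε₂ * frobNorm (T.site i j))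

/-- The relative error in the represented tensor under the perturbation `(Δ, δ)`. -/
noncomputable def relError (T : PEPS 𝕜 m n d) (Δ : ∀ j, T.ColIdx j → 𝕜)
    (δ : ∀ i j, T.SiteIdx i j → 𝕜) : ℝ :=
  frobNorm (T.perturbedTensor Δ δ - T.tensor) / frobNorm T.tensor

/-- The relative errors of all `(ε₁, ε₂)`-perturbations. -/
def errorSet (T : PEPS 𝕜 m n d) (ε₁ ε₂ : ℝ) : Set ℝ :=
  {e | ∃ Δ δ, T.IsPerturbation ε₁ ε₂ Δ δ ∧ e = T.relError Δ δ}

/-- The worst-case relative error over all `(ε₁, ε₂)`-perturbations. -/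
noncomputable def worstError (T : PEPS 𝕜 m n d) (ε₁ ε₂ : ℝ) : ℝ :=
  sSup (T.errorSet ε₁ ε₂)

end PEPS

/-! Both suprema are compared with first-order expansions.

A PEPS is a chain of columns, and each column a chain of sites. Peel a chain from the left: the
remaining tensor is fed into the second leg of the peeled one. An operator bound `o` and a
perturbation of Frobenius norm at most `a` per link thus change the result by at most `∏ (o + a) - ∏
o` (`frobNorm_openChain_sub_le`).

In a canonical PEPS the non-center columns and the center-column sites above the corner have
operator norm 1 and Frobenius norm at most `D^(m/2)` and `√D`, while the corner has the norm of the
whole tensor. To first order the relative error is therefore at most the numerator of `Φ`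
(`IsCanonical.relError_le`). Conversely, rescaling every constituent of any PEPS by `1 + ε₁` or `1 +
ε₂` is an admissible perturbation, so its worst error is at least the denominator of `Φ`
(`PEPS.le_worstError`). Dividing gives part 1.

For part 2, take sites that copy one bond leg to the physical leg, with weight 1 at index 0 and a
small `t > 0` elsewhere (`weightedPEPS`). Every constituent has full rank but is nearly a unit
vector, so submultiplicativity of the Frobenius norm bounds the worst error of `T` by nearly the
denominator of `Φ` over `‖T‖`. Only the bond entering the corner can be nonzero in the contraction,
so all weights can be moved into the corner; the other sites then have weight 1, which is a
canonical form. Perturbing it only at the zero index, by the full allowed norm, already reaches the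
numerator of `Φ` over `‖T‖` in the single entry at the origin. -/

theorem frobNorm_sq {𝕜 ι : Type*} [RCLike 𝕜] [Fintype ι] (f : ι → 𝕜) :
    frobNorm f ^ 2 = ∑ x, ‖f x‖ ^ 2 := by
  simp [frobNorm, EuclideanSpace.norm_sq_eq]

theorem frobNorm_nonneg {𝕜 ι : Type*} [RCLike 𝕜] [Fintype ι] (f : ι → 𝕜) : 0 ≤ frobNorm f :=
  norm_nonneg _

theorem frobNorm_add_le {𝕜 ι : Type*} [RCLike 𝕜] [Fintype ι] (f g : ι → 𝕜) :
    frobNorm (f + g) ≤ frobNorm f + frobNorm g :=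
  norm_add_le (WithLp.toLp 2 f : EuclideanSpace 𝕜 ι) (WithLp.toLp 2 g)

theorem frobNorm_zero {𝕜 ι : Type*} [RCLike 𝕜] [Fintype ι] : frobNorm (0 : ι → 𝕜) = 0 :=
  norm_zero (E := EuclideanSpace 𝕜 ι)

theorem frobNorm_smul {𝕜 ι : Type*} [RCLike 𝕜] [Fintype ι] (c : 𝕜) (f : ι → 𝕜) :
    frobNorm (c • f) = ‖c‖ * frobNorm f :=
  norm_smul c (WithLp.toLp 2 f : EuclideanSpace 𝕜 ι)

theorem frobNorm_pos {𝕜 ι : Type*} [RCLike 𝕜] [Fintype ι] {f : ι → 𝕜} (hf : f ≠ 0) :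
    0 < frobNorm f := by
  refine norm_pos_iff.2 fun h => hf ?_
  simpa using h

theorem norm_le_frobNorm {𝕜 ι : Type*} [RCLike 𝕜] [Fintype ι] (f : ι → 𝕜) (x : ι) :
    ‖f x‖ ≤ frobNorm f :=
  PiLp.norm_apply_le (WithLp.toLp 2 f : EuclideanSpace 𝕜 ι) x

theorem frobNorm_comp_equiv {𝕜 ι κ : Type*} [RCLike 𝕜] [Fintype ι] [Fintype κ] (f : ι → 𝕜)
    (e : κ ≃ ι) : frobNorm (f ∘ e) = frobNorm f := by
  rw [← sq_eq_sq₀ (frobNorm_nonneg _) (frobNorm_nonneg _), frobNorm_sq, frobNorm_sq]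
  exact e.sum_comp fun x => ‖f x‖ ^ 2

/-! ### Operator bounds and isometries of three-leg tensors. -/

/-- The tensor `B`, seen as a linear map from its second index to the two other ones, has operator
norm at most `o`. -/
def HasOpBound {𝕜 Y Z Q : Type*} [RCLike 𝕜] [Fintype Y] [Fintype Z] [Fintype Q]
    (B : Y × Z × Q → 𝕜) (o : ℝ) : Prop :=
  ∀ v : Z → 𝕜, ∑ y, ∑ q, ‖∑ z, B (y, z, q) * v z‖ ^ 2 ≤ o ^ 2 * ∑ z, ‖v z‖ ^ 2

/-- The tensor `B`, seen as a linear map from its second index to the two other ones, is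
isometric. -/
def IsTensorIsometry {𝕜 Y Z Q : Type*} [RCLike 𝕜] [Fintype Y] [Fintype Z] [Fintype Q]
    (B : Y × Z × Q → 𝕜) : Prop :=
  ∀ v : Z → 𝕜, ∑ y, ∑ q, ‖∑ z, B (y, z, q) * v z‖ ^ 2 = ∑ z, ‖v z‖ ^ 2

theorem IsTensorIsometry.hasOpBound {𝕜 Y Z Q : Type*} [RCLike 𝕜] [Fintype Y] [Fintype Z]
    [Fintype Q] {B : Y × Z × Q → 𝕜} (h : IsTensorIsometry B) : HasOpBound B 1 := fun v => by
  rw [h v]; simp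

/-- Cauchy–Schwarz for each pair of output indices. This is the only operator bound available for a
PEPS that is not canonical. -/
theorem hasOpBound_frobNorm {𝕜 Y Z Q : Type*} [RCLike 𝕜] [Fintype Y] [Fintype Z]
    [Fintype Q] (B : Y × Z × Q → 𝕜) : HasOpBound B (frobNorm B) := fun v => by
  have key : ∀ y q, ‖∑ z, B (y, z, q) * v z‖ ^ 2 ≤
      (∑ z, ‖B (y, z, q)‖ ^ 2) * ∑ z, ‖v z‖ ^ 2 := fun y q => by
    refine le_trans ?_ (Finset.sum_mul_sq_le_sq_mul_sq _ _ _)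
    gcongr
    refine (norm_sum_le _ _).trans (le_of_eq ?_)
    simp
  calc _ ≤ ∑ y, ∑ q, (∑ z, ‖B (y, z, q)‖ ^ 2) * ∑ z, ‖v z‖ ^ 2 :=
        Finset.sum_le_sum fun y _ => Finset.sum_le_sum fun q _ => key y q
    _ = _ := by
      rw [frobNorm_sq, Fintype.sum_prod_type, Finset.sum_mul]
      refine Finset.sum_congr rfl fun y _ => ?_
      rw [← Finset.sum_mul, Fintype.sum_prod_type, Finset.sum_comm]

theorem ofReal_sum_norm_sq {𝕜 ι : Type*} [RCLike 𝕜] [Fintype ι] (w : ι → 𝕜) :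
    ((∑ x, ‖w x‖ ^ 2 : ℝ) : 𝕜) = dotProduct (star w) w := by
  simp [dotProduct, RCLike.conj_mul]

/-- A tensor whose matricization has orthonormal columns is isometric. -/
theorem isTensorIsometry_of_conjTranspose_mul {𝕜 Y Z Q X : Type*} [RCLike 𝕜] [Fintype Y]
    [Fintype Z] [Fintype Q] [Fintype X] [DecidableEq Z] {B : Y × Z × Q → 𝕜} (e : Y × Q ≃ X)
    (M : Matrix X Z 𝕜) (hM : ∀ y z q, M (e (y, q)) z = B (y, z, q))
    (h : M.conjTranspose * M = 1) : IsTensorIsometry B := fun v => by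
  have h1 : ∑ y, ∑ q, ‖∑ z, B (y, z, q) * v z‖ ^ 2 = ∑ x, ‖(M.mulVec v) x‖ ^ 2 := by
    rw [← e.sum_comp, Fintype.sum_prod_type]
    simp only [Matrix.mulVec, dotProduct, hM]
  rw [h1, ← RCLike.ofReal_inj (K := 𝕜), ofReal_sum_norm_sq, ofReal_sum_norm_sq,
    Matrix.star_mulVec, ← Matrix.dotProduct_mulVec,
    Matrix.mulVec_mulVec, h, Matrix.one_mulVec]

/-- The squared Frobenius norm of an isometric tensor is the dimension of its domain. -/
theorem IsTensorIsometry.frobNorm_sq_eq {𝕜 Y Z Q : Type*} [RCLike 𝕜] [Fintype Y] [Fintype Z]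
    [Fintype Q] {B : Y × Z × Q → 𝕜} (h : IsTensorIsometry B) :
    frobNorm B ^ 2 = Fintype.card Z := by
  classical
  -- Testing the isometry on a basis vector shows that each slice has unit norm.
  have hz : ∀ z, ∑ y, ∑ q, ‖B (y, z, q)‖ ^ 2 = 1 := fun z => by
    simpa [Pi.single_apply, apply_ite, ite_pow] using h (Pi.single z 1)
  have hs : ∑ z, ∑ y, ∑ q, ‖B (y, z, q)‖ ^ 2 = Fintype.card Z := by simp [hz]
  rw [frobNorm_sq, ← hs, Finset.sum_comm, Fintype.sum_prod_type]
  simp only [Fintype.sum_prod_type]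

/-! ### Contraction of two tensors. -/

/-- Contraction of the second index of `B` with the first index of `R`. -/
def glue {𝕜 Y Z Q W : Type*} [RCLike 𝕜] [Fintype Z] (B : Y × Z × Q → 𝕜) (R : Z × W → 𝕜)
    (x : Y × Q × W) : 𝕜 :=
  ∑ z, B (x.1, z, x.2.1) * R (z, x.2.2)

theorem frobNorm_glue_sq {𝕜 Y Z Q W : Type*} [RCLike 𝕜] [Fintype Y] [Fintype Z] [Fintype Q]
    [Fintype W] (B : Y × Z × Q → 𝕜) (R : Z × W → 𝕜) :
    frobNorm (glue B R) ^ 2 = ∑ w, ∑ y, ∑ q, ‖∑ z, B (y, z, q) * R (z, w)‖ ^ 2 := by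
  rw [frobNorm_sq, Finset.sum_comm, Fintype.sum_prod_type]
  refine Finset.sum_congr rfl fun y _ => ?_
  rw [Fintype.sum_prod_type, Finset.sum_comm]
  rfl

theorem frobNorm_prod_sq {𝕜 Z W : Type*} [RCLike 𝕜] [Fintype Z] [Fintype W] (R : Z × W → 𝕜) :
    frobNorm R ^ 2 = ∑ w, ∑ z, ‖R (z, w)‖ ^ 2 := by
  rw [frobNorm_sq, Fintype.sum_prod_type, Finset.sum_comm]

theorem HasOpBound.frobNorm_glue_le {𝕜 Y Z Q W : Type*} [RCLike 𝕜] [Fintype Y] [Fintype Z]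
    [Fintype Q] [Fintype W] {B : Y × Z × Q → 𝕜} {o : ℝ} (h : HasOpBound B o) (ho : 0 ≤ o)
    (R : Z × W → 𝕜) : frobNorm (glue B R) ≤ o * frobNorm R := by
  rw [← sq_le_sq₀ (frobNorm_nonneg _) (mul_nonneg ho (frobNorm_nonneg _)), frobNorm_glue_sq,
    mul_pow, frobNorm_prod_sq, Finset.mul_sum]
  exact Finset.sum_le_sum fun w _ => h fun z => R (z, w)

theorem IsTensorIsometry.frobNorm_glue {𝕜 Y Z Q W : Type*} [RCLike 𝕜] [Fintype Y] [Fintype Z]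
    [Fintype Q] [Fintype W] {B : Y × Z × Q → 𝕜} (h : IsTensorIsometry B)
    (R : Z × W → 𝕜) : frobNorm (glue B R) = frobNorm R := by
  rw [← sq_eq_sq₀ (frobNorm_nonneg _) (frobNorm_nonneg _), frobNorm_glue_sq, frobNorm_prod_sq]
  exact Finset.sum_congr rfl fun w _ => h fun z => R (z, w)

/-- Error propagation through one contraction. -/
theorem frobNorm_glue_sub_glue_le {𝕜 Y Z Q W : Type*} [RCLike 𝕜] [Fintype Y] [Fintype Z]
    [Fintype Q] [Fintype W] {B B' : Y × Z × Q → 𝕜} {R R' : Z × W → 𝕜} {o a ρ e : ℝ}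
    (h : HasOpBound B o) (ho : 0 ≤ o) (ha : frobNorm (B' - B) ≤ a)
    (hR : frobNorm R ≤ ρ) (he : frobNorm (R' - R) ≤ e) :
    frobNorm (glue B' R' - glue B R) ≤ o * e + a * (ρ + e) := by
  -- Pairing `B' - B` with the perturbed `R'` includes the mixed term, so the bounds telescope into
  -- products along a chain.
  have hsplit : glue B' R' - glue B R = glue B (R' - R) + glue (B' - B) R' := by
    funext x
    simp only [glue, Pi.sub_apply, Pi.add_apply, ← Finset.sum_sub_distrib,
      ← Finset.sum_add_distrib]
    exact Finset.sum_congr rfl fun z _ => by ring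
  have hR' : frobNorm R' ≤ ρ + e := by
    have := frobNorm_add_le R (R' - R)
    rw [add_sub_cancel] at this
    linarith
  rw [hsplit]
  refine (frobNorm_add_le _ _).trans (add_le_add ?_ ?_)
  · exact (h.frobNorm_glue_le ho _).trans (by gcongr)
  · refine ((hasOpBound_frobNorm _).frobNorm_glue_le (frobNorm_nonneg _) _).trans ?_
    exact mul_le_mul ha hR' (frobNorm_nonneg _) ((frobNorm_nonneg _).trans ha)

/-! ### Chains of contractions. -/

/-- Contraction of a chain of tensors, with the leftmost bond left open. -/
def openChain {𝕜 : Type*} [RCLike 𝕜] {n : ℕ} (X : Fin (n + 1) → Type) (P : Fin n → Type)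
    [∀ j, Fintype (X j)] (B : ∀ j : Fin n, X j.castSucc × X j.succ × P j → 𝕜)
    (y : X 0 × ∀ j, P j) : 𝕜 :=
  ∑ h : ∀ j : Fin n, X j.succ,
    ∏ j, B j ((Fin.cons y.1 h : ∀ j, X j) j.castSucc, h j, y.2 j)

/-- The open left bond of the shorter chain is the one contracted with `B 0`; this recursion drives
all inductions on chains. -/
theorem openChain_succ {𝕜 : Type*} [RCLike 𝕜] {n : ℕ} (X : Fin (n + 2) → Type)
    (P : Fin (n + 1) → Type) [∀ j, Fintype (X j)]
    (B : ∀ j : Fin (n + 1), X j.castSucc × X j.succ × P j → 𝕜) (y : X 0 × ∀ j, P j) :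
    openChain X P B y =
      glue (B 0) (openChain (fun j => X j.succ) (fun j => P j.succ) fun j => B j.succ)
        (y.1, y.2 0, fun j => y.2 j.succ) := by
  unfold openChain glue
  rw [← (Fin.consEquiv fun j => X j.succ).sum_comp, Fintype.sum_prod_type]
  refine Finset.sum_congr rfl fun b _ => ?_
  rw [Finset.mul_sum]
  refine Finset.sum_congr rfl fun h _ => ?_
  rw [Fin.prod_univ_succ]
  rfl

theorem frobNorm_openChain_zero {𝕜 : Type*} [RCLike 𝕜] (X : Fin 1 → Type)
    (P : Fin 0 → Type) [∀ j, Fintype (X j)] [∀ j, Fintype (P j)]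
    (B : ∀ j : Fin 0, X j.castSucc × X j.succ × P j → 𝕜) (h : Fintype.card (X 0) = 1) :
    frobNorm (openChain X P B) = 1 := by
  rw [← sq_eq_sq₀ (frobNorm_nonneg _) zero_le_one, frobNorm_sq, Fintype.sum_prod_type]
  simp [openChain, h]

/-- Splitting the first physical index off. -/
def splitFirst {n : ℕ} (X : Fin (n + 2) → Type) (P : Fin (n + 1) → Type) :
    (X 0 × ∀ j, P j) ≃ X (Fin.castSucc 0) × P 0 × ∀ j : Fin n, P j.succ :=
  Equiv.prodCongr (Equiv.refl _) (Fin.consEquiv P).symm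

theorem openChain_succ' {𝕜 : Type*} [RCLike 𝕜] {n : ℕ} (X : Fin (n + 2) → Type)
    (P : Fin (n + 1) → Type) [∀ j, Fintype (X j)]
    (B : ∀ j : Fin (n + 1), X j.castSucc × X j.succ × P j → 𝕜) :
    openChain X P B =
      glue (B 0) (openChain (fun j => X j.succ) (fun j => P j.succ) fun j => B j.succ) ∘
        splitFirst X P :=
  funext fun y => openChain_succ X P B y

/-- Error propagation through a chain of contractions. -/
theorem frobNorm_openChain_sub_le {𝕜 : Type*} [RCLike 𝕜] {n : ℕ} (X : Fin (n + 1) → Type)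
    (P : Fin n → Type) [∀ j, Fintype (X j)] [∀ j, Fintype (P j)]
    (B B' : ∀ j : Fin n, X j.castSucc × X j.succ × P j → 𝕜) (o a : Fin n → ℝ)
    (hX : Fintype.card (X (Fin.last n)) = 1) (hB : ∀ j, HasOpBound (B j) (o j))
    (ho : ∀ j, 0 ≤ o j) (ha : ∀ j, frobNorm (B' j - B j) ≤ a j) :
    frobNorm (openChain X P B) ≤ ∏ j, o j ∧
      frobNorm (openChain X P B' - openChain X P B) ≤ ∏ j, (o j + a j) - ∏ j, o j := by
  induction n with
  | zero =>
    refine ⟨by simp [frobNorm_openChain_zero X P B hX], ?_⟩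
    have : openChain X P B' = openChain X P B := by funext y; simp [openChain]
    simp [this, frobNorm_zero]
  | succ n ih =>
    obtain ⟨ih1, ih2⟩ := ih (fun j => X j.succ) (fun j => P j.succ) (fun j => B j.succ)
      (fun j => B' j.succ) (fun j => o j.succ) (fun j => a j.succ) hX (fun j => hB j.succ)
      (fun j => ho j.succ) (fun j => ha j.succ)
    rw [openChain_succ', openChain_succ' X P B', Fin.prod_univ_succ, Fin.prod_univ_succ]
    constructor
    · rw [frobNorm_comp_equiv]
      exact ((hB 0).frobNorm_glue_le (ho 0) _).trans (mul_le_mul_of_nonneg_left ih1 (ho 0))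
    -- Here `ρ + e` is the product of the `o j + a j` over the tail, which closes the induction.
    · have := frobNorm_glue_sub_glue_le (hB 0) (ho 0) (ha 0) ih1 ih2
      rw [← frobNorm_comp_equiv _ (splitFirst X P), Pi.sub_comp] at this
      refine this.trans (le_of_eq ?_)
      ring

theorem frobNorm_glue_one {𝕜 Y Z Q W : Type*} [RCLike 𝕜] [Fintype Y] [Fintype Z] [Fintype Q]
    [Fintype W] (B : Y × Z × Q → 𝕜) (R : Z × W → 𝕜) (hZ : Fintype.card Z = 1)
    (hW : Fintype.card W = 1) (hR : ∀ x, R x = 1) : frobNorm (glue B R) = frobNorm B := by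
  obtain ⟨_⟩ := Fintype.card_eq_one_iff_nonempty_unique.1 hZ
  obtain ⟨_⟩ := Fintype.card_eq_one_iff_nonempty_unique.1 hW
  rw [← sq_eq_sq₀ (frobNorm_nonneg _) (frobNorm_nonneg _), frobNorm_glue_sq, frobNorm_sq]
  simp [Fintype.sum_prod_type, hR]

/-- Isometric tensors in a chain do not change the norm. -/
theorem frobNorm_openChain_eq {𝕜 : Type*} [RCLike 𝕜] {n : ℕ} (X : Fin (n + 2) → Type)
    (P : Fin (n + 1) → Type) [∀ j, Fintype (X j)] [∀ j, Fintype (P j)]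
    (B : ∀ j : Fin (n + 1), X j.castSucc × X j.succ × P j → 𝕜)
    (hX : Fintype.card (X (Fin.last _)) = 1)
    (hB : ∀ j : Fin n, IsTensorIsometry (B j.castSucc)) :
    frobNorm (openChain X P B) = frobNorm (B (Fin.last n)) := by
  induction n with
  | zero =>
    rw [openChain_succ', frobNorm_comp_equiv]
    exact frobNorm_glue_one _ _ hX (by simp) fun x => by simp [openChain]
  | succ n ih =>
    rw [openChain_succ', frobNorm_comp_equiv]
    refine ((hB 0).frobNorm_glue _).trans ?_
    exact ih (fun j => X j.succ) (fun j => P j.succ) (fun j => B j.succ) hX fun j => hB j.succ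

/-- Contracting a leftmost bond of dimension one is just leaving it open. -/
theorem sum_prod_eq_openChain {𝕜 : Type*} [RCLike 𝕜] {n : ℕ} (X : Fin (n + 1) → Type)
    (P : Fin n → Type) [∀ j, Fintype (X j)] [Unique (X 0)]
    (B : ∀ j : Fin n, X j.castSucc × X j.succ × P j → 𝕜) (p : ∀ j, P j) :
    ∑ h : ∀ j, X j, ∏ j : Fin n, B j (h j.castSucc, h j.succ, p j) =
      openChain X P B (default, p) := by
  rw [← (Fin.consEquiv X).sum_comp, Fintype.sum_prod_type, openChain, Fintype.sum_unique]
  rfl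

/-! ### Columns and whole PEPS as chains. -/

namespace PEPS

variable {𝕜 : Type*} [RCLike 𝕜] {m n : ℕ} {d : Fin m → Fin n → ℕ}

/-- The upper boundary leg of a column has only one index. -/
@[reducible]
def uniqueTop (T : PEPS 𝕜 m n d) (j : Fin n) : Unique (Fin (T.vbond 0 j)) :=
  (finCongr (T.vbond_top j)).unique

/-- The left boundary legs have only one index. -/
@[reducible]
def uniqueLeft (T : PEPS 𝕜 m n d) : Unique (T.CutIdx 0) :=
  @Pi.unique _ _ fun i => (finCongr (T.hbond_left i)).unique

/-- The legs of a site that do not connect it to other sites of its column. -/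
abbrev OuterIdx (T : PEPS 𝕜 m n d) (j : Fin n) (i : Fin m) : Type :=
  Fin (T.hbond i j.castSucc) × Fin (T.hbond i j.succ) × Fin (d i j)

/-- The legs of a site, sorted into upper leg, lower leg, other legs. -/
def siteEquiv (T : PEPS 𝕜 m n d) (i : Fin m) (j : Fin n) :
    Fin (T.vbond i.castSucc j) × Fin (T.vbond i.succ j) × T.OuterIdx j i ≃ T.SiteIdx i j where
  toFun x := (x.2.2.1, x.2.2.2.1, x.1, x.2.1, x.2.2.2.2)
  invFun x := (x.2.2.1, x.2.2.2.1, x.1, x.2.1, x.2.2.2.2)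
  left_inv _ := rfl
  right_inv _ := rfl

/-- The legs of a column, sorted by rows. -/
def colEquiv (T : PEPS 𝕜 m n d) (j : Fin n) :
    T.ColIdx j ≃ Fin (T.vbond 0 j) × ∀ i, T.OuterIdx j i where
  toFun x := ((T.uniqueTop j).default, fun i => (x.1 i, x.2.1 i, x.2.2 i))
  invFun x := (fun i => (x.2 i).1, fun i => (x.2 i).2.1, fun i => (x.2 i).2.2)
  left_inv _ := rfl
  right_inv _ := Prod.ext ((T.uniqueTop j).uniq _).symm rfl

/-- The physical legs, sorted by columns. -/
def physEquiv (T : PEPS 𝕜 m n d) :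
    (∀ i j, Fin (d i j)) ≃ T.CutIdx 0 × ∀ j, ∀ i, Fin (d i j) where
  toFun p := (T.uniqueLeft.default, fun j i => p i j)
  invFun x i j := x.2 j i
  left_inv _ := rfl
  right_inv _ := Prod.ext (T.uniqueLeft.uniq _).symm rfl

theorem contractCol_eq_openChain (T : PEPS 𝕜 m n d) (j : Fin n) (A : ∀ i, T.SiteIdx i j → 𝕜) :
    T.contractCol j A =
      openChain (fun i => Fin (T.vbond i j)) (T.OuterIdx j) (fun i => A i ∘ T.siteEquiv i j) ∘
        T.colEquiv j := by
  funext x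
  let _ := T.uniqueTop j
  exact sum_prod_eq_openChain (fun i => Fin (T.vbond i j)) (T.OuterIdx j)
    (fun i => A i ∘ T.siteEquiv i j) fun i => (x.1 i, x.2.1 i, x.2.2 i)

theorem contractRows_eq_openChain (T : PEPS 𝕜 m n d) (B : ∀ j, T.ColIdx j → 𝕜) :
    T.contractRows B =
      openChain T.CutIdx (fun j => ∀ i, Fin (d i j)) B ∘ T.physEquiv := by
  funext p
  let _ := T.uniqueLeft
  exact sum_prod_eq_openChain T.CutIdx (fun j => ∀ i, Fin (d i j)) B fun j i => p i j

theorem card_cutIdx_last {𝕜 : Type*} {m n : ℕ} {d : Fin m → Fin n → ℕ} (T : PEPS 𝕜 m n d) :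
    Fintype.card (T.CutIdx (Fin.last n)) = 1 := by
  simp [CutIdx, T.hbond_right]

theorem frobNorm_contractCol_sub_le (T : PEPS 𝕜 m n d) (j : Fin n)
    (A A' : ∀ i, T.SiteIdx i j → 𝕜) (o a : Fin m → ℝ)
    (hA : ∀ i, HasOpBound (A i ∘ T.siteEquiv i j) (o i)) (ho : ∀ i, 0 ≤ o i)
    (ha : ∀ i, frobNorm (A' i - A i) ≤ a i) :
    frobNorm (T.contractCol j A) ≤ ∏ i, o i ∧
      frobNorm (T.contractCol j A' - T.contractCol j A) ≤ ∏ i, (o i + a i) - ∏ i, o i := by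
  rw [contractCol_eq_openChain, contractCol_eq_openChain, ← Pi.sub_comp, frobNorm_comp_equiv,
    frobNorm_comp_equiv]
  refine frobNorm_openChain_sub_le _ _ _ _ o a (by simp [T.vbond_bottom]) hA ho fun i => ?_
  rw [← Pi.sub_comp, frobNorm_comp_equiv]
  exact ha i

theorem frobNorm_contractRows_sub_le (T : PEPS 𝕜 m n d)
    (B B' : ∀ j, T.ColIdx j → 𝕜) (o a : Fin n → ℝ)
    (hB : ∀ j, HasOpBound (B j) (o j)) (ho : ∀ j, 0 ≤ o j)
    (ha : ∀ j, frobNorm (B' j - B j) ≤ a j) :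
    frobNorm (T.contractRows B) ≤ ∏ j, o j ∧
      frobNorm (T.contractRows B' - T.contractRows B) ≤ ∏ j, (o j + a j) - ∏ j, o j := by
  rw [contractRows_eq_openChain, contractRows_eq_openChain, ← Pi.sub_comp, frobNorm_comp_equiv,
    frobNorm_comp_equiv]
  exact frobNorm_openChain_sub_le _ _ _ _ o a T.card_cutIdx_last hB ho ha

theorem frobNorm_siteEquiv (T : PEPS 𝕜 m n d) (i : Fin m) (j : Fin n) (A : T.SiteIdx i j → 𝕜) :
    HasOpBound (A ∘ T.siteEquiv i j) (frobNorm A) := by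
  rw [← frobNorm_comp_equiv A (T.siteEquiv i j)]
  exact hasOpBound_frobNorm _

theorem IsCanonical.isTensorIsometry_col {T : PEPS 𝕜 m n d} (h : T.IsCanonical) {j : Fin n}
    (hj : (j : ℕ) + 1 < n) : IsTensorIsometry (T.col j) :=
  isTensorIsometry_of_conjTranspose_mul (Equiv.refl _) (T.colMat j) (fun _ _ _ => rfl) (h.1 j hj)

/-- The rows of `siteMatDown`, with the upper leg moved to the front. -/
def downEquiv (T : PEPS 𝕜 m n d) (i : Fin m) (j : Fin n) :
    Fin (T.vbond i.castSucc j) × T.OuterIdx j i ≃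
      Fin (T.hbond i j.castSucc) × Fin (T.hbond i j.succ) × Fin (T.vbond i.castSucc j) ×
        Fin (d i j) where
  toFun x := (x.2.1, x.2.2.1, x.1, x.2.2.2)
  invFun x := (x.2.2.1, x.1, x.2.1, x.2.2.2)
  left_inv _ := rfl
  right_inv _ := rfl

theorem IsCanonical.isTensorIsometry_site {T : PEPS 𝕜 m n d} (h : T.IsCanonical) {i : Fin m}
    {j : Fin n} (hi : (i : ℕ) + 1 < m) (hj : (j : ℕ) + 1 = n) :
    IsTensorIsometry (T.site i j ∘ T.siteEquiv i j) :=
  isTensorIsometry_of_conjTranspose_mul (T.downEquiv i j) (T.siteMatDown i j) (fun _ _ _ => rfl)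
    (h.2 i j hi hj)

/-- The source of the factor `D^(m/2)`: a relative perturbation is measured against this norm,
although the operator norm is only 1. The site version below gives `√D` in the same way. -/
theorem IsCanonical.frobNorm_col_sq {T : PEPS 𝕜 m n d} (h : T.IsCanonical) {j : Fin n}
    (hj : (j : ℕ) + 1 < n) : frobNorm (T.col j) ^ 2 = ∏ i, (T.hbond i j.succ : ℝ) := by
  rw [(h.isTensorIsometry_col hj).frobNorm_sq_eq]
  simp [CutIdx]

theorem IsCanonical.frobNorm_site_sq {T : PEPS 𝕜 m n d} (h : T.IsCanonical) {i : Fin m}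
    {j : Fin n} (hi : (i : ℕ) + 1 < m) (hj : (j : ℕ) + 1 = n) :
    frobNorm (T.site i j) ^ 2 = T.vbond i.succ j := by
  rw [← frobNorm_comp_equiv _ (T.siteEquiv i j), (h.isTensorIsometry_site hi hj).frobNorm_sq_eq]
  simp

end PEPS

/-! ### Errors of general PEPS: upper bound by norms, lower bound by scaling. -/

namespace PEPS

variable {𝕜 : Type*} [RCLike 𝕜]

theorem frobNorm_contractRows_eq {m n : ℕ} {d : Fin m → Fin (n + 1) → ℕ}
    (T : PEPS 𝕜 m (n + 1) d) (B : ∀ j, T.ColIdx j → 𝕜)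
    (hB : ∀ j : Fin n, IsTensorIsometry (B j.castSucc)) :
    frobNorm (T.contractRows B) = frobNorm (B (Fin.last n)) := by
  rw [contractRows_eq_openChain, frobNorm_comp_equiv]
  exact frobNorm_openChain_eq T.CutIdx (fun j => ∀ i, Fin (d i j)) B T.card_cutIdx_last hB

theorem frobNorm_contractCol_eq {m n : ℕ} {d : Fin (m + 1) → Fin n → ℕ}
    (T : PEPS 𝕜 (m + 1) n d) (j : Fin n) (A : ∀ i, T.SiteIdx i j → 𝕜)
    (hA : ∀ i : Fin m, IsTensorIsometry (A i.castSucc ∘ T.siteEquiv i.castSucc j)) :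
    frobNorm (T.contractCol j A) = frobNorm (A (Fin.last m)) := by
  rw [contractCol_eq_openChain, frobNorm_comp_equiv,
    ← frobNorm_comp_equiv (A (Fin.last m)) (T.siteEquiv _ j)]
  exact frobNorm_openChain_eq (fun i => Fin (T.vbond i j)) (T.OuterIdx j)
    (fun i => A i ∘ T.siteEquiv i j) (by simp [T.vbond_bottom]) hA

/-- The norm of the tensor represented by a canonical PEPS is the norm of the corner site. -/
theorem IsCanonical.frobNorm_tensor {m n : ℕ} {d : Fin (m + 1) → Fin (n + 1) → ℕ}
    {T : PEPS 𝕜 (m + 1) (n + 1) d} (h : T.IsCanonical) :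
    frobNorm T.tensor = frobNorm (T.site (Fin.last m) (Fin.last n)) :=
  (T.frobNorm_contractRows_eq T.col fun j => h.isTensorIsometry_col (j := j.castSucc) (by simp)).trans
    (T.frobNorm_contractCol_eq _ _ fun i =>
      h.isTensorIsometry_site (i := i.castSucc) (by simp) (by simp))

/-- The error caused by a perturbation, in terms of operator bounds of columns and sites. -/
theorem frobNorm_perturbedTensor_sub_le {m n : ℕ} {d : Fin m → Fin (n + 1) → ℕ}
    (T : PEPS 𝕜 m (n + 1) d) (Δ : ∀ j, T.ColIdx j → 𝕜) (δ : ∀ i j, T.SiteIdx i j → 𝕜)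
    (o a : Fin n → ℝ) (o' a' : Fin m → ℝ)
    (hcol : ∀ j : Fin n, HasOpBound (T.col j.castSucc) (o j)) (ho : ∀ j, 0 ≤ o j)
    (hΔ : ∀ j : Fin n, frobNorm (Δ j.castSucc) ≤ a j)
    (hsite : ∀ i, HasOpBound (T.site i (Fin.last n) ∘ T.siteEquiv i (Fin.last n)) (o' i))
    (ho' : ∀ i, 0 ≤ o' i) (hδ : ∀ i, frobNorm (δ i (Fin.last n)) ≤ a' i) :
    frobNorm T.tensor ≤ (∏ j, o j) * ∏ i, o' i ∧
      frobNorm (T.perturbedTensor Δ δ - T.tensor) ≤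
        (∏ j, (o j + a j)) * ∏ i, (o' i + a' i) - (∏ j, o j) * ∏ i, o' i := by
  obtain ⟨h1, h2⟩ := T.frobNorm_contractCol_sub_le (Fin.last n) (fun i => T.site i _)
    (fun i => T.site i _ + δ i _) o' a' hsite ho' fun i => by rw [add_sub_cancel_left]; exact hδ i
  have hpos : 0 ≤ ∏ i, o' i := Finset.prod_nonneg fun i _ => ho' i
  have key := T.frobNorm_contractRows_sub_le T.col (fun j =>
      if (j : ℕ) + 1 < n + 1 then T.col j + Δ j
      else T.contractCol j fun i => T.site i j + δ i j)
    -- The contracted last column is the final link of the chain: its Frobenius norm serves as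
    -- operator bound, and its own chain estimate as perturbation size.
    (Fin.snoc (α := fun _ => ℝ) o (∏ i, o' i))
    (Fin.snoc (α := fun _ => ℝ) a (∏ i, (o' i + a' i) - ∏ i, o' i))
    (fun j => by
      refine Fin.lastCases ?_ (fun j => ?_) j
      · rw [Fin.snoc_last]
        intro v
        refine (hasOpBound_frobNorm _ v).trans ?_
        gcongr
        exacts [frobNorm_nonneg _, h1]
      · rw [Fin.snoc_castSucc]
        exact hcol j)
    (fun j => by
      refine Fin.lastCases ?_ (fun j => ?_) j
      · rwa [Fin.snoc_last]
      · rw [Fin.snoc_castSucc]; exact ho j)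
    (fun j => by
      refine Fin.lastCases ?_ (fun j => ?_) j
      · simpa [Fin.snoc_last, col] using h2
      · simpa [Fin.snoc_castSucc] using hΔ j)
  simp only [Fin.prod_univ_castSucc, Fin.snoc_castSucc, Fin.snoc_last, add_sub_cancel] at key
  exact key

theorem contractCol_smul {m n : ℕ} {d : Fin m → Fin n → ℕ} (T : PEPS 𝕜 m n d) (j : Fin n)
    (c : 𝕜) (A : ∀ i, T.SiteIdx i j → 𝕜) :
    (T.contractCol j fun i => c • A i) = c ^ m • T.contractCol j A := by
  funext x
  simp [contractCol, Finset.prod_mul_distrib, Finset.mul_sum]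

theorem contractRows_smul {m n : ℕ} {d : Fin m → Fin n → ℕ} (T : PEPS 𝕜 m n d)
    (c : Fin n → 𝕜) (B : ∀ j, T.ColIdx j → 𝕜) :
    (T.contractRows fun j => c j • B j) = (∏ j, c j) • T.contractRows B := by
  funext x
  simp [contractRows, Finset.prod_mul_distrib, Finset.mul_sum]

theorem isPerturbation_zero {m n : ℕ} {d : Fin m → Fin n → ℕ} (T : PEPS 𝕜 m n d) {ε₁ ε₂ : ℝ}
    (h₁ : 0 ≤ ε₁) (h₂ : 0 ≤ ε₂) : T.IsPerturbation ε₁ ε₂ 0 0 := by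
  refine ⟨fun j _ => ?_, fun i j _ => ?_⟩ <;>
    simpa [frobNorm_zero] using mul_nonneg (by assumption) (frobNorm_nonneg _)

theorem errorSet_nonempty {m n : ℕ} {d : Fin m → Fin n → ℕ} (T : PEPS 𝕜 m n d) {ε₁ ε₂ : ℝ}
    (h₁ : 0 ≤ ε₁) (h₂ : 0 ≤ ε₂) : (T.errorSet ε₁ ε₂).Nonempty :=
  ⟨_, 0, 0, T.isPerturbation_zero h₁ h₂, rfl⟩

theorem relError_nonneg {m n : ℕ} {d : Fin m → Fin n → ℕ} (T : PEPS 𝕜 m n d)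
    (Δ : ∀ j, T.ColIdx j → 𝕜) (δ : ∀ i j, T.SiteIdx i j → 𝕜) : 0 ≤ T.relError Δ δ :=
  div_nonneg (frobNorm_nonneg _) (frobNorm_nonneg _)

theorem worstError_nonneg {m n : ℕ} {d : Fin m → Fin n → ℕ} (T : PEPS 𝕜 m n d) (ε₁ ε₂ : ℝ) :
    0 ≤ T.worstError ε₁ ε₂ :=
  Real.sSup_nonneg <| by
    rintro _ ⟨Δ, δ, -, rfl⟩
    exact T.relError_nonneg Δ δ

/-- The norm of the columns but the last and of the sites of the last column, multiplied. -/
noncomputable def normProd {m n : ℕ} {d : Fin m → Fin (n + 1) → ℕ} (T : PEPS 𝕜 m (n + 1) d) : ℝ :=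
  (∏ j : Fin n, frobNorm (T.col j.castSucc)) * ∏ i, frobNorm (T.site i (Fin.last n))

theorem normProd_nonneg {m n : ℕ} {d : Fin m → Fin (n + 1) → ℕ} (T : PEPS 𝕜 m (n + 1) d) :
    0 ≤ T.normProd :=
  mul_nonneg (Finset.prod_nonneg fun _ _ => frobNorm_nonneg _)
    (Finset.prod_nonneg fun _ _ => frobNorm_nonneg _)

/-- The bound on the error in terms of the norms of the constituents. -/
theorem relError_le_normProd {m n : ℕ} {d : Fin m → Fin (n + 1) → ℕ} (T : PEPS 𝕜 m (n + 1) d)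
    {ε₁ ε₂ : ℝ} {Δ : ∀ j, T.ColIdx j → 𝕜} {δ : ∀ i j, T.SiteIdx i j → 𝕜}
    (h : T.IsPerturbation ε₁ ε₂ Δ δ) :
    T.relError Δ δ ≤ ((1 + ε₁) ^ n * (1 + ε₂) ^ m - 1) * (T.normProd / frobNorm T.tensor) := by
  have key := (T.frobNorm_perturbedTensor_sub_le Δ δ _ _ _ _
    (fun j => hasOpBound_frobNorm (T.col j.castSucc)) (fun _ => frobNorm_nonneg _)
    (fun j => h.1 j.castSucc (by simp)) (fun i => T.frobNorm_siteEquiv i _ (T.site i _))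
    (fun _ => frobNorm_nonneg _) (fun i => h.2 i (Fin.last n) (by simp))).2
  rw [relError, mul_div_assoc']
  refine div_le_div_of_nonneg_right (key.trans (le_of_eq ?_)) (frobNorm_nonneg _)
  simp only [← one_add_mul, Finset.prod_mul_distrib, Finset.prod_const, Finset.card_univ,
    Fintype.card_fin, normProd]
  ring

theorem bddAbove_errorSet {m n : ℕ} {d : Fin m → Fin (n + 1) → ℕ} (T : PEPS 𝕜 m (n + 1) d)
    (ε₁ ε₂ : ℝ) : BddAbove (T.errorSet ε₁ ε₂) :=
  ⟨_, by rintro _ ⟨Δ, δ, h, rfl⟩; exact T.relError_le_normProd h⟩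

/-- Scaling all constituents by a common factor shows that the error is at least the sum of the
relative perturbations. -/
theorem le_worstError {m n : ℕ} {d : Fin m → Fin (n + 1) → ℕ} (T : PEPS 𝕜 m (n + 1) d)
    (hT : T.tensor ≠ 0) {ε₁ ε₂ : ℝ} (h₁ : 0 ≤ ε₁) (h₂ : 0 ≤ ε₂) :
    ε₁ * n + ε₂ * m ≤ T.worstError ε₁ ε₂ := by
  have hp : T.IsPerturbation ε₁ ε₂ (fun j => (ε₁ : 𝕜) • T.col j)
      (fun i j => (ε₂ : 𝕜) • T.site i j) := by
    refine ⟨fun j _ => ?_, fun i j _ => ?_⟩ <;>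
      rw [frobNorm_smul, RCLike.norm_of_nonneg (by assumption)]
  have ht : T.perturbedTensor (fun j => (ε₁ : 𝕜) • T.col j) (fun i j => (ε₂ : 𝕜) • T.site i j) =
      (((1 + ε₁) ^ n * (1 + ε₂) ^ m : ℝ) : 𝕜) • T.tensor := by
    -- The last column is perturbed sitewise, hence collects one factor per row.
    have : ∀ j : Fin (n + 1), (if (j : ℕ) + 1 < n + 1 then T.col j + (ε₁ : 𝕜) • T.col j
        else T.contractCol j fun i => T.site i j + (ε₂ : 𝕜) • T.site i j) =
        (if (j : ℕ) + 1 < n + 1 then 1 + (ε₁ : 𝕜) else (1 + (ε₂ : 𝕜)) ^ m) • T.col j := fun j => by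
      split_ifs
      · rw [add_smul, one_smul]
      · rw [col, ← contractCol_smul]
        simp only [add_smul, one_smul]
    rw [perturbedTensor, funext this, contractRows_smul, Fin.prod_univ_castSucc, tensor]
    simp
  have hpos := frobNorm_pos hT
  refine le_trans ?_ (le_csSup (T.bddAbove_errorSet ε₁ ε₂) ⟨_, _, hp, rfl⟩)
  -- Bernoulli's inequality for each power; the cross term is nonnegative.
  have hle : ε₁ * n + ε₂ * m ≤ (1 + ε₁) ^ n * (1 + ε₂) ^ m - 1 := by
    have e1 := one_add_mul_le_pow (by linarith : -2 ≤ ε₁) n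
    have e2 := one_add_mul_le_pow (by linarith : -2 ≤ ε₂) m
    have e3 := mul_le_mul e1 e2 (by positivity) (by positivity)
    have : 0 ≤ n * ε₁ * (m * ε₂) := by positivity
    linarith
  rw [relError, ht, le_div_iff₀ hpos]
  have : (((1 + ε₁) ^ n * (1 + ε₂) ^ m : ℝ) : 𝕜) • T.tensor - T.tensor =
      (((1 + ε₁) ^ n * (1 + ε₂) ^ m - 1 : ℝ) : 𝕜) • T.tensor := by
    rw [RCLike.ofReal_sub, sub_smul, RCLike.ofReal_one, one_smul]
  rw [this, frobNorm_smul, RCLike.norm_of_nonneg (le_trans (by positivity) hle)]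
  gcongr

end PEPS

/-! ### Uniform second-order remainder. -/

theorem Real.exp_le_one_add_add {s : ℝ} (hs : 0 ≤ s) : exp s ≤ 1 + s + s ^ 2 * exp s := by
  -- This says `exp s ≤ 1 + s * exp s`; inserting it into its own right side gives the claim.
  have h1 : (1 - s) * exp s ≤ 1 := by
    have := mul_le_mul_of_nonneg_right (one_sub_le_exp_neg s) (exp_pos s).le
    rwa [← exp_add, neg_add_cancel, exp_zero] at this
  nlinarith

/-- Second order bound for products of binomials. -/
theorem one_add_pow_mul_sub_one_le (N M : ℕ) (α β γ : ℝ) (hα : 0 ≤ α) (hβ : 0 ≤ β) (hγ : 0 ≤ γ) :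
    ∃ K : ℝ, 0 ≤ K ∧ ∀ x y : ℝ, 0 ≤ x → x ≤ 1 → 0 ≤ y → y ≤ 1 →
      (1 + x * α) ^ N * ((1 + y * β) ^ M * (1 + y * γ)) - 1 ≤
        x * (N * α) + y * (γ + M * β) + K * (x ^ 2 + y ^ 2) := by
  set a := N * α
  set b := γ + M * β
  have ha : 0 ≤ a := by positivity
  have hb : 0 ≤ b := by positivity
  refine ⟨(a ^ 2 + b ^ 2) * Real.exp (a + b), by positivity, fun x y hx hx1 hy hy1 => ?_⟩
  set s := x * a + y * b
  have hs : 0 ≤ s := by positivity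
  have hsab : s ≤ a + b := by nlinarith
  have hexp : ∀ z : ℝ, 1 + z ≤ Real.exp z := fun z => by linarith [Real.add_one_le_exp z]
  have h1 : (1 + x * α) ^ N * ((1 + y * β) ^ M * (1 + y * γ)) ≤ Real.exp s := by
    have e : Real.exp s = Real.exp (x * α) ^ N * (Real.exp (y * β) ^ M * Real.exp (y * γ)) := by
      rw [← Real.exp_nat_mul, ← Real.exp_nat_mul, ← Real.exp_add, ← Real.exp_add]
      congr 1
      simp only [s, a, b]
      ring
    rw [e]
    gcongr <;> exact hexp _
  have h2 : s ^ 2 ≤ (a ^ 2 + b ^ 2) * (x ^ 2 + y ^ 2) := by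
    nlinarith [sq_nonneg (x * b - y * a)]
  have h3 : s ^ 2 * Real.exp s ≤ (a ^ 2 + b ^ 2) * (x ^ 2 + y ^ 2) * Real.exp (a + b) := by
    gcongr
  have := Real.exp_le_one_add_add hs
  linarith

/-! ### Part 1: the error of a canonical form. -/

namespace PEPS

variable {𝕜 : Type*} [RCLike 𝕜]

/-- The bound on the error of a canonical PEPS. -/
theorem IsCanonical.relError_le {m n D : ℕ} {d : Fin (m + 1) → Fin (n + 1) → ℕ}
    {T : PEPS 𝕜 (m + 1) (n + 1) d} (hT : T.IsCanonical) (hD : T.BondsLE D) (h0 : T.tensor ≠ 0)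
    {ε₁ ε₂ : ℝ} (h₁ : 0 ≤ ε₁) (h₂ : 0 ≤ ε₂)
    {Δ : ∀ j, T.ColIdx j → 𝕜} {δ : ∀ i j, T.SiteIdx i j → 𝕜} (h : T.IsPerturbation ε₁ ε₂ Δ δ) :
    T.relError Δ δ ≤ (1 + ε₁ * (D : ℝ) ^ (((m + 1 : ℕ) : ℝ) / 2)) ^ n *
      ((1 + ε₂ * Real.sqrt D) ^ m * (1 + ε₂ * 1)) - 1 := by
  have hpos := frobNorm_pos h0
  have hcol : ∀ j : Fin n, frobNorm (Δ j.castSucc) ≤ ε₁ * (D : ℝ) ^ (((m + 1 : ℕ) : ℝ) / 2) := by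
    intro j
    refine (h.1 j.castSucc (by simp)).trans (mul_le_mul_of_nonneg_left ?_ h₁)
    rw [← sq_le_sq₀ (frobNorm_nonneg _) (by positivity), hT.frobNorm_col_sq (by simp),
      ← Real.rpow_mul_natCast (Nat.cast_nonneg _)]
    norm_num
    calc _ ≤ ∏ i : Fin (m + 1), (D : ℝ) :=
          Finset.prod_le_prod (fun _ _ => Nat.cast_nonneg _) fun i _ => by exact_mod_cast hD.1 i _
      _ = (D : ℝ) ^ (m + 1) := by simp
      _ = _ := by exact_mod_cast (Real.rpow_natCast (D : ℝ) (m + 1)).symm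
  have hsite : ∀ i : Fin m, frobNorm (δ i.castSucc (Fin.last n)) ≤ ε₂ * Real.sqrt D := by
    intro i
    refine (h.2 i.castSucc (Fin.last n) (by simp)).trans (mul_le_mul_of_nonneg_left ?_ h₂)
    refine Real.le_sqrt_of_sq_le ?_
    rw [hT.frobNorm_site_sq (by simp) (by simp)]
    exact_mod_cast hD.2 _ _
  -- The corner enters with norm `‖T‖`, which cancels on division; hence its contribution to `Φ` is
  -- 1 rather than `√D`.
  have key := (T.frobNorm_perturbedTensor_sub_le Δ δ (fun _ => 1)
    (fun _ => ε₁ * (D : ℝ) ^ (((m + 1 : ℕ) : ℝ) / 2))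
    (Fin.snoc (α := fun _ => ℝ) (fun _ => 1) (frobNorm T.tensor))
    (Fin.snoc (α := fun _ => ℝ) (fun _ => ε₂ * Real.sqrt D) (ε₂ * frobNorm T.tensor))
    (fun j => (hT.isTensorIsometry_col (by simp)).hasOpBound) (fun _ => zero_le_one) hcol
    (fun i => by
      refine Fin.lastCases ?_ (fun i => ?_) i
      · rw [Fin.snoc_last, hT.frobNorm_tensor]
        exact T.frobNorm_siteEquiv _ _ _
      · rw [Fin.snoc_castSucc]
        exact (hT.isTensorIsometry_site (by simp) (by simp)).hasOpBound)
    (fun i => by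
      refine Fin.lastCases ?_ (fun i => ?_) i
      · rw [Fin.snoc_last]
        exact hpos.le
      · rw [Fin.snoc_castSucc]
        exact zero_le_one)
    (fun i => by
      refine Fin.lastCases ?_ (fun i => ?_) i
      · rw [Fin.snoc_last, hT.frobNorm_tensor]
        exact h.2 _ _ (by simp)
      · rw [Fin.snoc_castSucc]
        exact hsite i)).2
  rw [relError, div_le_iff₀ hpos]
  refine key.trans (le_of_eq ?_)
  simp only [Fin.prod_univ_castSucc, Fin.snoc_castSucc, Fin.snoc_last, Finset.prod_const,
    Finset.card_univ, Fintype.card_fin, one_pow]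
  ring

/-- The error of a canonical form is bounded by a multiple of the error of the original PEPS. -/
theorem exists_worstError_canonical_le (m n D : ℕ) :
    ∃ K : ℝ, ∀ (d : Fin (m + 1) → Fin (n + 1) → ℕ) (T C : PEPS 𝕜 (m + 1) (n + 1) d),
      T.tensor ≠ 0 → C.IsCanonical → C.tensor = T.tensor → C.BondsLE D →
      ∀ ε₁ ε₂ : ℝ, 0 ≤ ε₁ → ε₁ ≤ 1 → 0 ≤ ε₂ → ε₂ ≤ 1 →
        0 < ε₁ * n + ε₂ * (m + 1 : ℕ) →
        C.worstError ε₁ ε₂ ≤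
          (ε₁ * (n * (D : ℝ) ^ (((m + 1 : ℕ) : ℝ) / 2)) + ε₂ * (1 + m * Real.sqrt D)) /
            (ε₁ * n + ε₂ * (m + 1 : ℕ)) * T.worstError ε₁ ε₂ + K * (ε₁ ^ 2 + ε₂ ^ 2) := by
  obtain ⟨K, -, hK⟩ := one_add_pow_mul_sub_one_le n m ((D : ℝ) ^ (((m + 1 : ℕ) : ℝ) / 2))
    (Real.sqrt D) 1 (by positivity) (by positivity) zero_le_one
  refine ⟨K, fun d T C hT hC hCT hD ε₁ ε₂ h₁ h₁' h₂ h₂' hpos => ?_⟩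
  refine csSup_le (C.errorSet_nonempty h₁ h₂) ?_
  rintro _ ⟨Δ, δ, h, rfl⟩
  refine (hC.relError_le hD (hCT ▸ hT) h₁ h₂ h).trans ((hK _ _ h₁ h₁' h₂ h₂').trans ?_)
  gcongr
  calc _ = (ε₁ * (n * (D : ℝ) ^ (((m + 1 : ℕ) : ℝ) / 2)) + ε₂ * (1 + m * Real.sqrt D)) /
            (ε₁ * n + ε₂ * (m + 1 : ℕ)) * (ε₁ * n + ε₂ * (m + 1 : ℕ)) :=
        (div_mul_cancel₀ _ hpos.ne').symm
    _ ≤ _ := by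
      gcongr
      exact T.le_worstError hT h₁ h₂

end PEPS

/-! ### Part 2: tools for sparse tensors. -/

theorem frobNorm_le_sqrt {𝕜 ι : Type*} [RCLike 𝕜] [Fintype ι] {f : ι → 𝕜} {t : ℝ} (x₀ : ι)
    (h₀ : ‖f x₀‖ ≤ 1) (h : ∀ x, x ≠ x₀ → ‖f x‖ ≤ t) :
    frobNorm f ≤ Real.sqrt (1 + t ^ 2 * Fintype.card ι) := by
  classical
  refine Real.le_sqrt_of_sq_le ?_
  have hx : ∀ x, ‖f x‖ ^ 2 ≤ (if x = x₀ then 1 else 0) + t ^ 2 := fun x => by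
    split_ifs with hx
    · rw [hx]
      nlinarith [norm_nonneg (f x₀), sq_nonneg t]
    · rw [zero_add]
      exact pow_le_pow_left₀ (norm_nonneg _) (h x hx) 2
  rw [frobNorm_sq]
  refine (Finset.sum_le_sum fun x _ => hx x).trans (le_of_eq ?_)
  simp [Finset.sum_add_distrib, mul_comm]

theorem frobNorm_single {𝕜 ι : Type*} [RCLike 𝕜] [Fintype ι] [DecidableEq ι] (x : ι) (c : 𝕜) :
    frobNorm (Pi.single x c) = ‖c‖ := by
  rw [← sq_eq_sq₀ (frobNorm_nonneg _) (norm_nonneg _), frobNorm_sq]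
  simp [Pi.single_apply, apply_ite, ite_pow]

/-- A contraction in which only the zero indices contribute. -/
theorem sum_prod_eq_prod_of_corner {𝕜 : Type*} [RCLike 𝕜] {n : ℕ} (X : Fin (n + 2) → Type)
    [∀ j, Fintype (X j)] [∀ j, Zero (X j)] (F : ∀ j : Fin (n + 1), X j.castSucc → X j.succ → 𝕜)
    (h : ∀ j l r, l ≠ 0 ∨ r ≠ 0 → F j l r = 0) :
    ∑ b : ∀ j, X j, ∏ j : Fin (n + 1), F j (b j.castSucc) (b j.succ) = ∏ j, F j 0 0 := by
  classical
  rw [Finset.sum_eq_single (0 : ∀ j, X j)]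
  · rfl
  · intro b _ hb
    obtain ⟨k, hk⟩ := Function.ne_iff.1 hb
    -- Bond 0 is a left leg of the first factor; every other bond is the right leg of some factor.
    rcases Fin.eq_zero_or_eq_succ k with rfl | ⟨j, rfl⟩
    · exact Finset.prod_eq_zero (Finset.mem_univ 0) (h 0 _ _ (Or.inl hk))
    · exact Finset.prod_eq_zero (Finset.mem_univ j) (h j _ _ (Or.inr hk))
  · exact fun h => absurd (Finset.mem_univ _) h

/-- The columns are distinct standard basis vectors. -/
theorem conjTranspose_mul_self_eq_one_of_apply {𝕜 X Y : Type*} [RCLike 𝕜] [Fintype X]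
    [Fintype Y] [DecidableEq Y] {M : Matrix X Y 𝕜} (f : Y → X) (hf : Function.Injective f)
    (h1 : ∀ y, M (f y) y = 1) (h0 : ∀ x y, x ≠ f y → M x y = 0) : M.conjTranspose * M = 1 := by
  ext y z
  rw [Matrix.mul_apply, Finset.sum_eq_single (f y)]
  · rw [Matrix.conjTranspose_apply, h1, Matrix.one_apply]
    split_ifs with h
    · rw [← h, h1]; simp
    · rw [h0 _ _ (hf.ne h), mul_zero]
  · intro x _ hx
    simp [h0 x y hx]
  · exact fun h => absurd (Finset.mem_univ _) h

theorem linearIndependent_col_of_apply {𝕜 X Y : Type*} [RCLike 𝕜]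
    [Fintype Y] {M : Matrix X Y 𝕜} (f : Y → X) (hf : Function.Injective f)
    (h1 : ∀ y, M (f y) y ≠ 0) (h0 : ∀ x y, x ≠ f y → M x y = 0) :
    LinearIndependent 𝕜 M.col := by
  classical
  rw [Fintype.linearIndependent_iff]
  intro g hg y
  have := congrFun hg (f y)
  rw [Finset.sum_apply, Finset.sum_eq_single y] at this
  · simpa [Matrix.col_apply, h1 y] using this
  · intro z _ hz
    simp [Matrix.col_apply, h0 _ _ (hf.ne hz.symm)]
  · exact fun h => absurd (Finset.mem_univ _) h

/-! ### The extremal PEPS and its canonical form. -/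

/-- The support of the site tensors of `weightedPEPS`: the left leg is `0`, and the physical leg
agrees with the right leg, in the last column with the lower leg, and at the corner with the upper
leg; other legs are `0`. -/
def siteSupport (M N i j l r u v p : ℕ) : Prop :=
  l = 0 ∧ if j = N then if i = M then p = u else u = 0 ∧ p = v else u = 0 ∧ v = 0 ∧ p = r

/-- The entries of the site tensors of `weightedPEPS` on their support. -/
def siteWeight {𝕜 : Type*} (w c : ℕ → 𝕜) (M N i j r u v : ℕ) : 𝕜 :=
  if j = N then if i = M then c u else w v else w r

open Classical in
/-- A PEPS all of whose bonds have dimension `D`, and whose sites copy one bond leg to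
the physical leg. -/
noncomputable def weightedPEPS {𝕜 : Type*} [RCLike 𝕜] (M N D d : ℕ) (w c : ℕ → 𝕜) :
    PEPS 𝕜 (M + 1) (N + 1) (fun _ _ => d) where
  hbond _ j := if j = 0 ∨ j = Fin.last _ then 1 else D
  vbond i _ := if i = 0 ∨ i = Fin.last _ then 1 else D
  hbond_left := by simp
  hbond_right := by simp
  vbond_top := by simp
  vbond_bottom := by simp
  site i j x :=
    if siteSupport M N i j x.1 x.2.1 x.2.2.1 x.2.2.2.1 x.2.2.2.2 then
      siteWeight w c M N i j x.2.1 x.2.2.1 x.2.2.2.1 else 0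

namespace weightedPEPS

variable {𝕜 : Type*} [RCLike 𝕜] {M N D d : ℕ} {w c : ℕ → 𝕜}

theorem hbond_eq (i : Fin (M + 1)) {j : Fin (N + 2)} (h0 : j ≠ 0) (h1 : j ≠ Fin.last _) :
    (weightedPEPS M N D d w c).hbond i j = D := by
  simp [weightedPEPS, h0, h1]

theorem vbond_eq {i : Fin (M + 2)} (j : Fin (N + 1)) (h0 : i ≠ 0) (h1 : i ≠ Fin.last _) :
    (weightedPEPS M N D d w c).vbond i j = D := by
  simp [weightedPEPS, h0, h1]

theorem bondsEq : (weightedPEPS M N D d w c).BondsEq D :=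
  ⟨fun i _ h0 h1 => hbond_eq i h0 h1, fun _ j h0 h1 => vbond_eq j h0 h1⟩

instance neZero_hbond [NeZero D] (i : Fin (M + 1)) (j : Fin (N + 2)) :
    NeZero ((weightedPEPS M N D d w c).hbond i j) := by
  simp only [weightedPEPS]
  split_ifs <;> infer_instance

instance neZero_vbond [NeZero D] (i : Fin (M + 2)) (j : Fin (N + 1)) :
    NeZero ((weightedPEPS M N D d w c).vbond i j) := by
  simp only [weightedPEPS]
  split_ifs <;> infer_instance

theorem hbond_le [NeZero D] (hd : D ≤ d) (i : Fin (M + 1)) (j : Fin (N + 2)) :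
    (weightedPEPS M N D d w c).hbond i j ≤ d := by
  have := NeZero.pos D
  simp only [weightedPEPS]
  split_ifs <;> omega

theorem vbond_le [NeZero D] (hd : D ≤ d) (i : Fin (M + 2)) (j : Fin (N + 1)) :
    (weightedPEPS M N D d w c).vbond i j ≤ d := by
  have := NeZero.pos D
  simp only [weightedPEPS]
  split_ifs <;> omega

theorem site_of_supp {i : Fin (M + 1)} {j : Fin (N + 1)}
    {x : (weightedPEPS M N D d w c).SiteIdx i j}
    (h : siteSupport M N i j x.1 x.2.1 x.2.2.1 x.2.2.2.1 x.2.2.2.2) :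
    (weightedPEPS M N D d w c).site i j x = siteWeight w c M N i j x.2.1 x.2.2.1 x.2.2.2.1 :=
  if_pos h

theorem site_of_not_supp {i : Fin (M + 1)} {j : Fin (N + 1)}
    {x : (weightedPEPS M N D d w c).SiteIdx i j}
    (h : ¬ siteSupport M N i j x.1 x.2.1 x.2.2.1 x.2.2.2.1 x.2.2.2.2) :
    (weightedPEPS M N D d w c).site i j x = 0 :=
  if_neg h

theorem right_last [NeZero D] (i : Fin (M + 1)) {j : Fin (N + 1)} (hj : (j : ℕ) = N)
    (r : Fin ((weightedPEPS M N D d w c).hbond i j.succ)) : r = 0 := by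
  obtain rfl : j = Fin.last N := Fin.ext hj
  have h1 : (weightedPEPS M N D d w c).hbond i (Fin.last N).succ = 1 :=
    (weightedPEPS M N D d w c).hbond_right i
  have h2 := r.isLt
  exact Fin.ext ((Nat.lt_one_iff.1 (h2.trans_eq h1)).trans (by simp))

theorem lower_last [NeZero D] {i : Fin (M + 1)} (j : Fin (N + 1)) (hi : (i : ℕ) = M)
    (v : Fin ((weightedPEPS M N D d w c).vbond i.succ j)) : v = 0 := by
  obtain rfl : i = Fin.last M := Fin.ext hi
  have h1 : (weightedPEPS M N D d w c).vbond (Fin.last M).succ j = 1 :=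
    (weightedPEPS M N D d w c).vbond_bottom j
  have h2 := v.isLt
  exact Fin.ext ((Nat.lt_one_iff.1 (h2.trans_eq h1)).trans (by simp))

theorem site_zero [NeZero D] [NeZero d] (hw : w 0 = 1) (hc : c 0 = 1) (i : Fin (M + 1))
    (j : Fin (N + 1)) : (weightedPEPS M N D d w c).site i j 0 = 1 := by
  refine (site_of_supp (by simp [siteSupport])).trans ?_
  simp [siteWeight, hw, hc]

/-- On the support the physical leg copies the only leg that can be nonzero. Hence entries at the
physical origin receive a single contribution, from all bonds 0. -/
theorem site_eq_zero_of_phys [NeZero D] [NeZero d] (i : Fin (M + 1)) (j : Fin (N + 1))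
    {l r u v} (h : (l, r, u, v, (0 : Fin d)) ≠ (0 : (weightedPEPS M N D d w c).SiteIdx i j)) :
    (weightedPEPS M N D d w c).site i j (l, r, u, v, 0) = 0 := by
  refine site_of_not_supp fun hs => h ?_
  have key : l = 0 ∧ r = 0 ∧ u = 0 ∧ v = 0 := by
    simp only [siteSupport, Fin.val_eq_zero_iff, Fin.val_zero] at hs
    obtain ⟨hl, hs⟩ := hs
    split_ifs at hs with hj hi
    · exact ⟨hl, right_last i hj r, Fin.ext (by simpa using hs.symm), lower_last j hi v⟩
    · exact ⟨hl, right_last i hj r, hs.1, Fin.ext (by simpa using hs.2.symm)⟩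
    · exact ⟨hl, Fin.ext (by simpa using hs.2.2.symm), hs.1, hs.2.1⟩
  obtain ⟨rfl, rfl, rfl, rfl⟩ := key
  rfl

/-- The columns but the last are products. -/
theorem col_eq [NeZero D] {j : Fin (N + 1)} (hj : (j : ℕ) ≠ N)
    (x : (weightedPEPS M N D d w c).ColIdx j) :
    (weightedPEPS M N D d w c).col j x =
      ∏ i, if (x.1 i : ℕ) = 0 ∧ (x.2.2 i : ℕ) = x.2.1 i then w (x.2.1 i) else 0 := by
  refine (sum_prod_eq_prod_of_corner
    (fun i => Fin ((weightedPEPS M N D d w c).vbond i j))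
    (fun i u v => (weightedPEPS M N D d w c).site i j (x.1 i, x.2.1 i, u, v, x.2.2 i))
    fun i u v h => site_of_not_supp fun hs => ?_).trans ?_
  · simp only [siteSupport, hj, if_false] at hs
    rcases h with h | h
    · exact h (Fin.ext (by simpa using hs.2.1))
    · exact h (Fin.ext (by simpa using hs.2.2.1))
  · refine Finset.prod_congr rfl fun i _ => ?_
    simp [weightedPEPS, siteSupport, siteWeight, hj]

/-- The right legs of a column determine the other indices in its support. -/
noncomputable def colSupp [NeZero D] (hd : D ≤ d) (j : Fin (N + 1))
    (r : (weightedPEPS M N D d w c).CutIdx j.succ) :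
    (weightedPEPS M N D d w c).CutIdx j.castSucc × (Fin (M + 1) → Fin d) :=
  (0, fun i => Fin.castLE (hbond_le hd i j.succ) (r i))

theorem colSupp_injective [NeZero D] (hd : D ≤ d) (j : Fin (N + 1)) :
    Function.Injective (colSupp (M := M) (w := w) (c := c) hd j) := fun r s h => by
  funext i
  simpa [colSupp] using congrFun (congrArg Prod.snd h) i

theorem colMat_colSupp [NeZero D] (hd : D ≤ d) {j : Fin (N + 1)} (hj : (j : ℕ) ≠ N)
    (r : (weightedPEPS M N D d w c).CutIdx j.succ) :
    (weightedPEPS M N D d w c).colMat j (colSupp hd j r) r = ∏ i, w (r i) := by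
  simp [PEPS.colMat, colSupp, col_eq hj]

theorem colMat_eq_zero [NeZero D] (hd : D ≤ d) {j : Fin (N + 1)} (hj : (j : ℕ) ≠ N)
    {x : (weightedPEPS M N D d w c).CutIdx j.castSucc × (Fin (M + 1) → Fin d)}
    {r : (weightedPEPS M N D d w c).CutIdx j.succ} (h : x ≠ colSupp hd j r) :
    (weightedPEPS M N D d w c).colMat j x r = 0 := by
  simp only [PEPS.colMat, Matrix.of_apply, col_eq hj]
  by_contra hne
  rw [Finset.prod_eq_zero_iff] at hne
  push Not at hne
  refine h (Prod.ext (funext fun i => ?_) (funext fun i => ?_))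
  · have := (ite_ne_right_iff.1 (hne i (Finset.mem_univ i))).1.1
    exact Fin.ext (by simpa [colSupp] using this)
  · have := (ite_ne_right_iff.1 (hne i (Finset.mem_univ i))).1.2
    exact Fin.ext (by simpa [colSupp] using this)

/-- The lower leg of a site of the last column determines the other indices in the support. -/
noncomputable def downSupp [NeZero D] (hd : D ≤ d) (i : Fin (M + 1)) (j : Fin (N + 1))
    (v : Fin ((weightedPEPS M N D d w c).vbond i.succ j)) :
    Fin ((weightedPEPS M N D d w c).hbond i j.castSucc) ×
      Fin ((weightedPEPS M N D d w c).hbond i j.succ) ×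
      Fin ((weightedPEPS M N D d w c).vbond i.castSucc j) × Fin d :=
  (0, 0, 0, Fin.castLE (vbond_le hd i.succ j) v)

theorem downSupp_injective [NeZero D] (hd : D ≤ d) (i : Fin (M + 1)) (j : Fin (N + 1)) :
    Function.Injective (downSupp (w := w) (c := c) hd i j) := fun r s h => by
  simpa [downSupp] using h

theorem siteMatDown_downSupp [NeZero D] (hd : D ≤ d) {i : Fin (M + 1)} {j : Fin (N + 1)}
    (hi : (i : ℕ) ≠ M) (hj : (j : ℕ) = N) (v : Fin ((weightedPEPS M N D d w c).vbond i.succ j)) :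
    (weightedPEPS M N D d w c).siteMatDown i j (downSupp hd i j v) v = w v := by
  refine (site_of_supp ?_).trans ?_ <;> simp [siteSupport, downSupp, siteWeight, hi, hj]

theorem siteMatDown_eq_zero [NeZero D] (hd : D ≤ d) {i : Fin (M + 1)} {j : Fin (N + 1)}
    (hi : (i : ℕ) ≠ M) (hj : (j : ℕ) = N) {x} {v : Fin ((weightedPEPS M N D d w c).vbond i.succ j)}
    (h : x ≠ downSupp hd i j v) :
    (weightedPEPS M N D d w c).siteMatDown i j x v = 0 := by
  refine site_of_not_supp fun hs => h ?_
  obtain ⟨l, r, u, p⟩ := x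
  simp only [siteSupport, hi, hj, if_true, if_false] at hs
  obtain rfl := right_last i hj r
  obtain rfl : l = 0 := Fin.ext (by simpa using hs.1)
  obtain rfl : u = 0 := Fin.ext (by simpa using hs.2.1)
  obtain rfl : p = Fin.castLE (vbond_le hd i.succ j) v := Fin.ext hs.2.2
  rfl

/-- The upper leg of the corner determines the other indices in the support. -/
noncomputable def upSupp [NeZero D] (hd : D ≤ d) (i : Fin (M + 1)) (j : Fin (N + 1))
    (u : Fin ((weightedPEPS M N D d w c).vbond i.castSucc j)) :
    Fin ((weightedPEPS M N D d w c).hbond i j.castSucc) ×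
      Fin ((weightedPEPS M N D d w c).hbond i j.succ) ×
      Fin ((weightedPEPS M N D d w c).vbond i.succ j) × Fin d :=
  (0, 0, 0, Fin.castLE (vbond_le hd i.castSucc j) u)

theorem upSupp_injective [NeZero D] (hd : D ≤ d) (i : Fin (M + 1)) (j : Fin (N + 1)) :
    Function.Injective (upSupp (w := w) (c := c) hd i j) := fun r s h => by
  simpa [upSupp] using h

theorem siteMatUp_upSupp [NeZero D] (hd : D ≤ d) {i : Fin (M + 1)} {j : Fin (N + 1)}
    (hi : (i : ℕ) = M) (hj : (j : ℕ) = N)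
    (u : Fin ((weightedPEPS M N D d w c).vbond i.castSucc j)) :
    (weightedPEPS M N D d w c).siteMatUp i j (upSupp hd i j u) u = c u := by
  refine (site_of_supp ?_).trans ?_ <;> simp [siteSupport, upSupp, siteWeight, hi, hj]

theorem siteMatUp_eq_zero [NeZero D] (hd : D ≤ d) {i : Fin (M + 1)} {j : Fin (N + 1)}
    (hi : (i : ℕ) = M) (hj : (j : ℕ) = N) {x}
    {u : Fin ((weightedPEPS M N D d w c).vbond i.castSucc j)} (h : x ≠ upSupp hd i j u) :
    (weightedPEPS M N D d w c).siteMatUp i j x u = 0 := by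
  refine site_of_not_supp fun hs => h ?_
  obtain ⟨l, r, v, p⟩ := x
  simp only [siteSupport, hi, hj, if_true] at hs
  obtain rfl := right_last i hj r
  obtain rfl := lower_last j hi v
  obtain rfl : l = 0 := Fin.ext (by simpa using hs.1)
  obtain rfl : p = Fin.castLE (vbond_le hd i.castSucc j) u := Fin.ext hs.2
  rfl

theorem isCanonical [NeZero D] (hd : D ≤ d) (hw : ∀ k, w k = 1) :
    (weightedPEPS M N D d w c).IsCanonical := by
  refine ⟨fun j hj => ?_, fun i j hi hj => ?_⟩
  · refine conjTranspose_mul_self_eq_one_of_apply _ (colSupp_injective hd j) (fun r => ?_)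
      fun x r h => colMat_eq_zero hd (by omega) h
    rw [colMat_colSupp hd (by omega)]
    simp [hw]
  · refine conjTranspose_mul_self_eq_one_of_apply _ (downSupp_injective hd i j) (fun v => ?_)
      fun x v h => siteMatDown_eq_zero hd (by omega) (by omega) h
    rw [siteMatDown_downSupp hd (by omega) (by omega), hw]

theorem hasFullRank [NeZero D] (hd : D ≤ d) (hw : ∀ k, w k ≠ 0) (hc : ∀ k, c k ≠ 0) :
    (weightedPEPS M N D d w c).HasFullRank := by
  refine ⟨fun j hj => ?_, fun i j hi hj => ?_, fun i j hi hj => ?_⟩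
  · refine linearIndependent_col_of_apply _ (colSupp_injective hd j) (fun r => ?_)
      fun x r h => colMat_eq_zero hd (by omega) h
    rw [colMat_colSupp hd (by omega)]
    exact Finset.prod_ne_zero_iff.2 fun i _ => hw _
  · refine linearIndependent_col_of_apply _ (downSupp_injective hd i j) (fun v => ?_)
      fun x v h => siteMatDown_eq_zero hd (by omega) (by omega) h
    rw [siteMatDown_downSupp hd (by omega) (by omega)]
    exact hw _
  · refine linearIndependent_col_of_apply _ (upSupp_injective hd i j) (fun u => ?_)
      fun x u h => siteMatUp_eq_zero hd (by omega) (by omega) h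
    rw [siteMatUp_upSupp hd (by omega) (by omega)]
    exact hc _

/-- The weights of the bonds can be absorbed into the corner. -/
theorem tensor_eq (hw : w 0 = 1) :
    (weightedPEPS M N D d w w).tensor =
      (weightedPEPS M N D d (fun _ => 1) fun k => w k ^ 2).tensor := by
  funext p
  rw [PEPS.tensor_eq_sum, PEPS.tensor_eq_sum]
  refine Finset.sum_congr rfl fun h _ => Finset.sum_congr rfl fun v _ => ?_
  -- The support does not depend on the weights, so off it both products vanish.
  by_cases H : ∀ (i : Fin (M + 1)) (j : Fin (N + 1)), siteSupport M N i j (h j.castSucc i) (h j.succ i) (v j i.castSucc)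
      (v j i.succ) (p i j)
  swap
  · push Not at H
    obtain ⟨i, j, hij⟩ := H
    exact (Finset.prod_eq_zero (Finset.mem_univ j) (Finset.prod_eq_zero (Finset.mem_univ i)
      (site_of_not_supp hij))).trans (Finset.prod_eq_zero (Finset.mem_univ j)
        (Finset.prod_eq_zero (Finset.mem_univ i) (site_of_not_supp hij))).symm
  have e1 : ∀ (j : Fin (N + 1)) (i : Fin (M + 1)), (weightedPEPS M N D d w w).site i j
      (h j.castSucc i, h j.succ i, v j i.castSucc, v j i.succ, p i j) =
      siteWeight w w M N i j (h j.succ i) (v j i.castSucc) (v j i.succ) := fun j i =>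
    site_of_supp (H i j)
  have e2 : ∀ (j : Fin (N + 1)) (i : Fin (M + 1)),
      (weightedPEPS M N D d (fun _ => (1 : 𝕜)) fun k => w k ^ 2).site i j
      (h j.castSucc i, h j.succ i, v j i.castSucc, v j i.succ, p i j) =
      siteWeight (fun _ => (1 : 𝕜)) (fun k => w k ^ 2) M N i j (h j.succ i) (v j i.castSucc)
        (v j i.succ) := fun j i =>
    site_of_supp (H i j)
  refine (Finset.prod_congr rfl fun j _ => Finset.prod_congr rfl fun i _ => e1 j i).trans
    (Eq.trans ?_ (Finset.prod_congr rfl fun j _ => Finset.prod_congr rfl fun i _ => e2 j i).symm)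
  -- A right leg of a column is a left leg of the next one, which the support forces to 0.
  have hcols : ∀ (j : Fin N) (i : Fin (M + 1)), w (h j.castSucc.succ i) = 1 := fun j i => by
    have : (h j.succ.castSucc i : ℕ) = 0 := (H i j.succ).1
    rw [show (h j.castSucc.succ i : ℕ) = 0 from this, hw]
  have hrows : ∀ i : Fin M, (v (Fin.last N) i.castSucc.castSucc : ℕ) = 0 := fun i => by
    have := (H i.castSucc (Fin.last N)).2
    simp only [Fin.val_last, if_true, Fin.val_castSucc, i.isLt.ne, if_false] at this
    exact this.1
  -- Only the bond entering the corner survives; it is weighted once from above and once by the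
  -- corner, hence the square. With a single row it is a boundary leg and equals 0.
  have hlast : (∏ i : Fin M, w (v (Fin.last N) i.castSucc.succ)) *
      w (v (Fin.last N) (Fin.last M).castSucc) = w (v (Fin.last N) (Fin.last M).castSucc) ^ 2 := by
    cases M with
    | zero =>
      have h1 : (weightedPEPS 0 N D d w w).vbond (Fin.last 0).castSucc (Fin.last N) = 1 :=
        (weightedPEPS 0 N D d w w).vbond_top _
      have h2 := Nat.lt_one_iff.1 ((v (Fin.last N) (Fin.last 0).castSucc).isLt.trans_eq h1)
      rw [h2, hw]
      simp
    | succ M =>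
      rw [Fin.prod_univ_castSucc, Finset.prod_eq_one, one_mul, sq]
      · rfl
      · intro i _
        have := hrows i.succ
        rw [show (v (Fin.last N) i.castSucc.castSucc.succ : ℕ) = 0 from this, hw]
  refine (Fin.prod_univ_castSucc _).trans (Eq.trans ?_ (Fin.prod_univ_castSucc _).symm)
  refine congrArg₂ (· * ·) ?_ ?_
  · refine Finset.prod_congr rfl fun j _ => Finset.prod_congr rfl fun i _ => ?_
    simp only [siteWeight, Fin.val_castSucc, j.isLt.ne, if_false, hcols]
  · rw [Fin.prod_univ_castSucc, Fin.prod_univ_castSucc]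
    simpa [siteWeight, Fin.val_castSucc, Fin.is_lt, ne_of_lt] using hlast

end weightedPEPS

/-! ### Worst errors of the extremal PEPS and of its canonical form. -/

namespace weightedPEPS

variable {𝕜 : Type*} [RCLike 𝕜] {M N D d : ℕ} {w c : ℕ → 𝕜}

/-- Stated for arbitrary `A` so that it also covers sites perturbed at the zero index. -/
theorem contractCol_phys_zero [NeZero D] [NeZero d] {j : Fin (N + 1)}
    {A : ∀ i, (weightedPEPS M N D d w c).SiteIdx i j → 𝕜}
    (hA : ∀ i l r u v, (l, r, u, v, (0 : Fin d)) ≠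
      (0 : (weightedPEPS M N D d w c).SiteIdx i j) → A i (l, r, u, v, 0) = 0)
    (l : (weightedPEPS M N D d w c).CutIdx j.castSucc)
    (r : (weightedPEPS M N D d w c).CutIdx j.succ) :
    (weightedPEPS M N D d w c).contractCol j A (l, r, 0) = ∏ i, A i (l i, r i, 0, 0, 0) :=
  sum_prod_eq_prod_of_corner (fun i => Fin ((weightedPEPS M N D d w c).vbond i j))
    (fun i u v => A i (l i, r i, u, v, 0)) fun i u v h => hA i _ _ _ _ fun h0 => by
      simp only [Prod.ext_iff] at h0
      exact h.elim (fun h => h h0.2.2.1) fun h => h h0.2.2.2.1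

theorem contractCol_eq_zero_of_phys [NeZero D] [NeZero d] {j : Fin (N + 1)}
    {A : ∀ i, (weightedPEPS M N D d w c).SiteIdx i j → 𝕜}
    (hA : ∀ i l r u v, (l, r, u, v, (0 : Fin d)) ≠
      (0 : (weightedPEPS M N D d w c).SiteIdx i j) → A i (l, r, u, v, 0) = 0)
    {l : (weightedPEPS M N D d w c).CutIdx j.castSucc}
    {r : (weightedPEPS M N D d w c).CutIdx j.succ} (h : l ≠ 0 ∨ r ≠ 0) :
    (weightedPEPS M N D d w c).contractCol j A (l, r, 0) = 0 := by
  rw [contractCol_phys_zero hA]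
  rcases h with h | h <;> obtain ⟨i, hi⟩ := Function.ne_iff.1 h <;>
    refine Finset.prod_eq_zero (Finset.mem_univ i) (hA i _ _ _ _ fun h0 => hi ?_) <;>
    simp only [Prod.ext_iff] at h0
  exacts [h0.1, h0.2.1]

theorem contractRows_phys_zero [NeZero D] [NeZero d]
    {B : ∀ j, (weightedPEPS M N D d w c).ColIdx j → 𝕜}
    (hB : ∀ j l r, l ≠ 0 ∨ r ≠ 0 → B j (l, r, 0) = 0) :
    (weightedPEPS M N D d w c).contractRows B 0 = ∏ j, B j 0 :=
  sum_prod_eq_prod_of_corner (weightedPEPS M N D d w c).CutIdx (fun j l r => B j (l, r, 0)) hB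

/-- The entry at the origin of a PEPS perturbed at the origin. -/
theorem perturbedTensor_zero_apply [NeZero D] [NeZero d] (hw : w 0 = 1) (hc : c 0 = 1)
    (a : 𝕜) (b : Fin (M + 1) → 𝕜) :
    (weightedPEPS M N D d w c).perturbedTensor (fun _ => Pi.single 0 a)
      (fun i _ => Pi.single 0 (b i)) 0 = (1 + a) ^ N * ∏ i, (1 + b i) := by
  have hsite : ∀ i j l r u v, (l, r, u, v, (0 : Fin d)) ≠
      (0 : (weightedPEPS M N D d w c).SiteIdx i j) →
      (weightedPEPS M N D d w c).site i j (l, r, u, v, 0) = 0 := fun i j _ _ _ _ h =>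
    site_eq_zero_of_phys i j h
  have hsite' : ∀ i j l r u v, (l, r, u, v, (0 : Fin d)) ≠
      (0 : (weightedPEPS M N D d w c).SiteIdx i j) →
      ((weightedPEPS M N D d w c).site i j + Pi.single 0 (b i) : _ → 𝕜) (l, r, u, v, 0) = 0 :=
    fun i j l r u v h => by rw [Pi.add_apply, hsite i j _ _ _ _ h, Pi.single_eq_of_ne h, zero_add]
  have hcol0 : ∀ j, (weightedPEPS M N D d w c).col j 0 = 1 := fun j =>
    (contractCol_phys_zero (fun i => hsite i j) 0 0).trans
      (Finset.prod_eq_one fun i _ => site_zero hw hc i j)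
  have hone : ∀ i j, ((weightedPEPS M N D d w c).site i j + Pi.single 0 (b i) : _ → 𝕜) 0 =
      1 + b i := fun i j => by rw [Pi.add_apply, site_zero hw hc, Pi.single_eq_same]
  have hlast : ∀ j, (weightedPEPS M N D d w c).contractCol j
      (fun i => (weightedPEPS M N D d w c).site i j + Pi.single 0 (b i)) 0 = ∏ i, (1 + b i) :=
    fun j => (contractCol_phys_zero (fun i => hsite' i j) 0 0).trans
      (Finset.prod_congr rfl fun i _ => hone i j)
  rw [PEPS.perturbedTensor, contractRows_phys_zero, Fin.prod_univ_castSucc, if_neg (by simp),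
    hlast]
  · refine congrArg (· * _) ?_
    refine (Finset.prod_congr rfl fun j _ => ?_).trans (by simp : ∏ _j : Fin N, (1 + a) = _)
    rw [if_pos (by simp), Pi.add_apply, hcol0, Pi.single_eq_same]
  · intro j l r h
    split_ifs
    · rw [Pi.add_apply, PEPS.col, contractCol_eq_zero_of_phys (fun i => hsite i j) h,
        Pi.single_eq_of_ne, zero_add]
      intro h0
      simp only [Prod.ext_iff] at h0
      exact h.elim (fun h => h h0.1) fun h => h h0.2.1
    · exact contractCol_eq_zero_of_phys (fun i => hsite' i j) h

theorem tensor_zero_apply [NeZero D] [NeZero d] (hw : w 0 = 1) (hc : c 0 = 1) :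
    (weightedPEPS M N D d w c).tensor 0 = 1 := by
  have h := perturbedTensor_zero_apply (M := M) (N := N) (D := D) (d := d) hw hc 0 0
  have h0 : (weightedPEPS M N D d w c).perturbedTensor 0 0 =
      (weightedPEPS M N D d w c).tensor := by
    simp [PEPS.perturbedTensor, PEPS.tensor, PEPS.col]
    rfl
  simp only [Pi.zero_apply, Pi.single_zero, add_zero, one_pow, Finset.prod_const_one,
    mul_one] at h
  rw [← h0, ← h]
  rfl

/-- A lower bound for the error of the PEPS with isometric sites. -/
theorem le_worstError [NeZero D] [NeZero d] (hd : D ≤ d) (hw : ∀ k, w k = 1) (hc : c 0 = 1)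
    {ε₁ ε₂ : ℝ} (h₁ : 0 ≤ ε₁) (h₂ : 0 ≤ ε₂) :
    ε₁ * (N * (D : ℝ) ^ (((M + 1 : ℕ) : ℝ) / 2)) + ε₂ * (1 + M * Real.sqrt D) ≤
      (weightedPEPS M N D d w c).worstError ε₁ ε₂ *
        frobNorm (weightedPEPS M N D d w c).tensor := by
  have hcan : (weightedPEPS M N D d w c).IsCanonical := isCanonical hd hw
  have h0 := tensor_zero_apply (M := M) (N := N) (D := D) (d := d) (hw 0) hc
  have hpos : 0 < frobNorm (weightedPEPS M N D d w c).tensor :=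
    lt_of_lt_of_le (by rw [h0]; simp) (norm_le_frobNorm _ 0)
  set α := (D : ℝ) ^ (((M + 1 : ℕ) : ℝ) / 2)
  -- Admissible sizes: the exact norms `√D` of the isometric sites, and for the corner the lower
  -- bound 1 given by its entry `c 0 = 1`.
  set β : Fin (M + 1) → ℝ := Fin.snoc (α := fun _ => ℝ) (fun _ => Real.sqrt D) 1 with hβ
  have hα : 0 ≤ α := by positivity
  have hβ0 : ∀ i, 0 ≤ β i := fun i => by
    refine Fin.lastCases ?_ (fun i => ?_) i
    · simp [hβ]
    · simp [hβ]
  have hp : (weightedPEPS M N D d w c).IsPerturbation ε₁ ε₂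
      (fun _ => Pi.single 0 ((ε₁ * α : ℝ) : 𝕜))
      (fun i _ => Pi.single 0 ((ε₂ * β i : ℝ) : 𝕜)) := by
    refine ⟨fun j hj => ?_, fun i j hj => ?_⟩
    · rw [frobNorm_single, RCLike.norm_of_nonneg (by positivity)]
      refine mul_le_mul_of_nonneg_left ?_ h₁
      rw [← sq_le_sq₀ hα (frobNorm_nonneg _), hcan.frobNorm_col_sq hj,
        ← Real.rpow_mul_natCast (Nat.cast_nonneg _), Finset.prod_congr rfl fun i _ =>
          congrArg (Nat.cast (R := ℝ)) (hbond_eq i (Fin.succ_ne_zero j)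
            (Fin.ne_of_lt (by simpa [Fin.lt_def] using hj)))]
      rw [Nat.cast_ofNat, div_mul_cancel₀ _ two_ne_zero, Real.rpow_natCast]
      simp
    · rw [frobNorm_single, RCLike.norm_of_nonneg (mul_nonneg h₂ (hβ0 i))]
      refine mul_le_mul_of_nonneg_left ?_ h₂
      rcases Fin.eq_castSucc_or_eq_last i with ⟨i, rfl⟩ | rfl
      · simp only [hβ, Fin.snoc_castSucc]
        rw [← sq_le_sq₀ (Real.sqrt_nonneg _) (frobNorm_nonneg _),
          hcan.frobNorm_site_sq (by simp) hj, Real.sq_sqrt (Nat.cast_nonneg _),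
          vbond_eq j (Fin.succ_ne_zero _) (Fin.ne_of_lt (by simp [Fin.lt_def]))]
      · simp only [hβ, Fin.snoc_last]
        refine le_trans (le_of_eq ?_) (norm_le_frobNorm _ 0)
        rw [site_zero (hw 0) hc, norm_one]
  have hval : ((weightedPEPS M N D d w c).perturbedTensor
      (fun _ => Pi.single 0 ((ε₁ * α : ℝ) : 𝕜))
      (fun i _ => Pi.single 0 ((ε₂ * β i : ℝ) : 𝕜)) - (weightedPEPS M N D d w c).tensor) 0 =
      (((1 + ε₁ * α) ^ N * ((1 + ε₂ * Real.sqrt D) ^ M * (1 + ε₂)) - 1 : ℝ) : 𝕜) := by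
    rw [Pi.sub_apply, h0, perturbedTensor_zero_apply (hw 0) hc, Fin.prod_univ_castSucc]
    simp [hβ]
  have hle : ε₁ * (N * α) + ε₂ * (1 + M * Real.sqrt D) ≤
      (1 + ε₁ * α) ^ N * ((1 + ε₂ * Real.sqrt D) ^ M * (1 + ε₂)) - 1 := by
    have e0 : 0 ≤ ε₁ * α := by positivity
    have e0' : 0 ≤ ε₂ * Real.sqrt D := by positivity
    have e1 := one_add_mul_le_pow (by linarith : -2 ≤ ε₁ * α) N
    have e2 := one_add_mul_le_pow (by linarith : -2 ≤ ε₂ * Real.sqrt D) M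
    have e3 := mul_le_mul e2 (le_refl (1 + ε₂)) (by positivity) (by positivity)
    have e4 := mul_le_mul e1 e3 (by positivity) (by positivity)
    have e5 : 0 ≤ M * (ε₂ * Real.sqrt D) * ε₂ := by positivity
    have e6 : 0 ≤ N * (ε₁ * α) * (ε₂ + M * (ε₂ * Real.sqrt D) + M * (ε₂ * Real.sqrt D) * ε₂) := by
      positivity
    linarith
  have hsup := le_csSup ((weightedPEPS M N D d w c).bddAbove_errorSet ε₁ ε₂) ⟨_, _, hp, rfl⟩
  rw [PEPS.relError, div_le_iff₀ hpos] at hsup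
  refine (hle.trans ?_).trans hsup
  refine le_trans ?_ (norm_le_frobNorm _ 0)
  rw [hval]
  exact (le_abs_self _).trans (RCLike.norm_ofReal _).ge

theorem norm_site_le [NeZero D] [NeZero d] {t : ℝ} (ht : 0 ≤ t)
    (hw : ∀ k, k ≠ 0 → ‖w k‖ ≤ t) (hc : ∀ k, k ≠ 0 → ‖c k‖ ≤ t) (i : Fin (M + 1))
    (j : Fin (N + 1)) (x : (weightedPEPS M N D d w c).SiteIdx i j) (hx : x ≠ 0) :
    ‖(weightedPEPS M N D d w c).site i j x‖ ≤ t := by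
  obtain ⟨l, r, u, v, p⟩ := x
  by_cases hp : p = 0
  · subst hp
    rwa [site_eq_zero_of_phys i j hx, norm_zero]
  by_cases hs : siteSupport M N i j l r u v p
  swap
  · rwa [site_of_not_supp hs, norm_zero]
  rw [site_of_supp hs]
  have hp' : (p : ℕ) ≠ 0 := fun h => hp (Fin.ext (by simpa using h))
  simp only [siteSupport] at hs
  simp only [siteWeight]
  obtain ⟨-, hs⟩ := hs
  split_ifs at hs ⊢
  · exact hc _ (hs ▸ hp')
  · exact hw _ (hs.2 ▸ hp')
  · exact hw _ (hs.2.2 ▸ hp')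

/-- A nonzero index on the support has a row with nonzero right leg, contributing a factor at most
`t`; the other rows contribute at most 1. -/
theorem norm_col_le [NeZero D] [NeZero d] (hd : D ≤ d) {t : ℝ} (ht : 0 ≤ t)
    (hw : ∀ k, k ≠ 0 → ‖w k‖ ≤ t) (hw1 : ∀ k, ‖w k‖ ≤ 1) {j : Fin (N + 1)} (hj : (j : ℕ) ≠ N)
    (x : (weightedPEPS M N D d w c).ColIdx j) (hx : x ≠ 0) :
    ‖(weightedPEPS M N D d w c).col j x‖ ≤ t := by
  obtain ⟨l, r, p⟩ := x
  change ‖(weightedPEPS M N D d w c).colMat j (l, p) r‖ ≤ t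
  by_cases h : (l, p) = colSupp hd j r
  swap
  · rwa [colMat_eq_zero hd hj h, norm_zero]
  rw [h, colMat_colSupp hd hj]
  have hr : r ≠ 0 := by
    rintro rfl
    obtain ⟨rfl, rfl⟩ := Prod.ext_iff.1 h
    refine hx ?_
    ext i <;> simp [colSupp]
  obtain ⟨i, hi⟩ := Function.ne_iff.1 hr
  rw [← Finset.mul_prod_erase _ _ (Finset.mem_univ i), norm_mul, norm_prod]
  exact (mul_le_of_le_one_right (norm_nonneg _)
    (Finset.prod_le_one (fun _ _ => norm_nonneg _) fun _ _ => hw1 _)).trans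
      (hw _ fun h => hi (Fin.ext (by simpa using h)))

/-- For small weights the product of the norms of the constituents is close to one. -/
theorem exists_normProd_lt [NeZero D] [NeZero d] (hd : D ≤ d) {η : ℝ} (hη : 0 < η) :
    ∃ w : ℕ → 𝕜, w 0 = 1 ∧ (∀ k, w k ≠ 0) ∧
      (weightedPEPS M N D d w w).normProd < 1 + η := by
  -- The index types are independent of the weights, so `V` supplies their sizes before `t` is
  -- chosen. The bound `g` is continuous with `g 0 = 1`.
  set V : PEPS 𝕜 (M + 1) (N + 1) (fun _ _ => d) := weightedPEPS M N D d (fun _ => 1) fun _ => 1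
  set g : ℝ → ℝ := fun t =>
    (∏ j : Fin N, Real.sqrt (1 + t ^ 2 * Fintype.card (V.ColIdx j.castSucc))) *
      ∏ i, Real.sqrt (1 + t ^ 2 * Fintype.card (V.SiteIdx i (Fin.last N))) with hg
  have hcont : Continuous g := by fun_prop
  have h0 : g 0 < 1 + η := by simpa [hg] using hη
  have hev : ∀ᶠ t in nhdsWithin 0 (Set.Ioi 0), g t < 1 + η :=
    nhdsWithin_le_nhds (hcont.continuousAt.eventually (gt_mem_nhds h0))
  obtain ⟨t, ht, ht0, ht1⟩ := (hev.and (Ioc_mem_nhdsGT (zero_lt_one (α := ℝ)))).exists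
  have hwt : ∀ k : ℕ, k ≠ 0 → ‖(if k = 0 then (1 : 𝕜) else (t : 𝕜))‖ ≤ t := fun k hk => by
    rw [if_neg hk, RCLike.norm_of_nonneg ht0.le]
  refine ⟨fun k => if k = 0 then 1 else (t : 𝕜), if_pos rfl, fun k => ?_, lt_of_le_of_lt ?_ ht⟩
  · dsimp only
    split_ifs
    exacts [one_ne_zero, by exact_mod_cast ht0.ne']
  · refine mul_le_mul ?_ ?_ (Finset.prod_nonneg fun _ _ => frobNorm_nonneg _)
      (Finset.prod_nonneg fun _ _ => Real.sqrt_nonneg _)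
    · refine Finset.prod_le_prod (fun _ _ => frobNorm_nonneg _) fun j _ => ?_
      refine frobNorm_le_sqrt 0 ?_ (norm_col_le hd ht0.le hwt (fun k => ?_) (by simp; omega))
      · rw [col_eq (by simp; omega)]
        simp
      · by_cases hk : k = 0
        · simp [hk]
        · exact (hwt k hk).trans ht1
    · refine Finset.prod_le_prod (fun _ _ => frobNorm_nonneg _) fun i _ => ?_
      refine frobNorm_le_sqrt 0 ?_ (norm_site_le ht0.le hwt hwt i _)
      rw [site_zero] <;> simp

end weightedPEPS

/-! ### Sharpness of the factor and conclusion. -/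

/-- The comparison factor is attained up to an arbitrarily small loss. -/
theorem exists_worstError_canonical_ge {𝕜 : Type*} [RCLike 𝕜] (M N D d : ℕ) (hD : 1 ≤ D)
    (hd : D ≤ d) {η : ℝ} (hη : 0 < η) :
    ∃ T C : PEPS 𝕜 (M + 1) (N + 1) (fun _ _ => d),
      T.tensor ≠ 0 ∧ C.IsCanonical ∧ C.tensor = T.tensor ∧
      T.BondsEq D ∧ C.BondsEq D ∧ T.HasFullRank ∧
      ∃ K : ℝ, ∀ ε₁ ε₂ : ℝ, 0 ≤ ε₁ → ε₁ ≤ 1 → 0 ≤ ε₂ → ε₂ ≤ 1 →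
        0 < ε₁ * N + ε₂ * (M + 1 : ℕ) →
        (1 - η) *
          ((ε₁ * (N * (D : ℝ) ^ (((M + 1 : ℕ) : ℝ) / 2)) + ε₂ * (1 + M * Real.sqrt D)) /
            (ε₁ * N + ε₂ * (M + 1 : ℕ))) * T.worstError ε₁ ε₂ ≤
          C.worstError ε₁ ε₂ + K * (ε₁ ^ 2 + ε₂ ^ 2) := by
  have : NeZero D := ⟨by omega⟩
  have : NeZero d := ⟨by omega⟩
  obtain ⟨w, hw0, hw, hlt⟩ := weightedPEPS.exists_normProd_lt (𝕜 := 𝕜) (M := M) (N := N) hd hη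
  have hc0 : w 0 ^ 2 = 1 := by rw [hw0, one_pow]
  have htensor := weightedPEPS.tensor_eq (M := M) (N := N) (D := D) (d := d) hw0
  have hC := fun ε₁ ε₂ => weightedPEPS.le_worstError (𝕜 := 𝕜) (M := M) (N := N)
    (w := fun _ => 1) (c := fun k => w k ^ 2) (ε₁ := ε₁) (ε₂ := ε₂) hd (fun _ => rfl) hc0
  have h0 := weightedPEPS.tensor_zero_apply (M := M) (N := N) (D := D) (d := d) hw0 hw0
  have hcan := weightedPEPS.isCanonical (𝕜 := 𝕜) (M := M) (N := N) (w := fun _ => 1)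
    (c := fun k => w k ^ 2) hd fun _ => rfl
  have hrank := weightedPEPS.hasFullRank (M := M) (N := N) hd hw hw
  have hTb := weightedPEPS.bondsEq (M := M) (N := N) (D := D) (d := d) (w := w) (c := w)
  have hCb := weightedPEPS.bondsEq (M := M) (N := N) (D := D) (d := d) (w := fun _ => (1 : 𝕜))
    (c := fun k => w k ^ 2)
  generalize weightedPEPS M N D d (fun _ => (1 : 𝕜)) (fun k => w k ^ 2) = C at *
  generalize weightedPEPS M N D d w w = T at *
  rw [← htensor] at hC
  -- The entry at the origin is 1.
  have hs : 1 ≤ frobNorm T.tensor := by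
    simpa [h0] using norm_le_frobNorm T.tensor 0
  obtain ⟨K, hK0, hK⟩ := one_add_pow_mul_sub_one_le N M 1 1 1 zero_le_one zero_le_one zero_le_one
  have hT : ∀ ε₁ ε₂ : ℝ, 0 ≤ ε₁ → ε₁ ≤ 1 → 0 ≤ ε₂ → ε₂ ≤ 1 → T.worstError ε₁ ε₂ ≤
      (ε₁ * N + ε₂ * (M + 1 : ℕ) + K * (ε₁ ^ 2 + ε₂ ^ 2)) *
        (T.normProd / frobNorm T.tensor) := fun ε₁ ε₂ h₁ h₁' h₂ h₂' => by
    refine csSup_le (T.errorSet_nonempty h₁ h₂) ?_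
    rintro _ ⟨Δ, δ, h, rfl⟩
    refine (T.relError_le_normProd h).trans (mul_le_mul_of_nonneg_right ?_
      (div_nonneg T.normProd_nonneg (frobNorm_nonneg _)))
    refine le_trans (le_of_eq ?_) ((hK ε₁ ε₂ h₁ h₁' h₂ h₂').trans (le_of_eq ?_))
    · ring
    · push_cast; ring
  refine ⟨T, C, fun h => one_ne_zero ((h0.symm.trans (congrFun h 0))), hcan, htensor.symm, hTb,
    hCb, hrank, ?_⟩
  set A := (D : ℝ) ^ (((M + 1 : ℕ) : ℝ) / 2)
  set S := Real.sqrt D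
  have hA : 0 ≤ A := by positivity
  have hS : 0 ≤ S := by positivity
  have hc := T.normProd_nonneg
  set c := T.normProd
  set s := frobNorm T.tensor
  have hs0 : 0 < s := by linarith
  -- The remainder of `T` is multiplied by `P / X ≤ A + 1 + S` and by `c / s ≤ c`.
  refine ⟨(A + 1 + S) * K * c, fun ε₁ ε₂ h₁ h₁' h₂ h₂' hpos => ?_⟩
  have hE := C.worstError_nonneg ε₁ ε₂
  have hET := T.worstError_nonneg ε₁ ε₂
  set q := ε₁ ^ 2 + ε₂ ^ 2
  have hq : 0 ≤ q := by positivity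
  set X := ε₁ * N + ε₂ * (M + 1 : ℕ)
  set P := ε₁ * (N * A) + ε₂ * (1 + M * S)
  have hP : 0 ≤ P := by positivity
  -- For `η ≥ 1` the left side is not positive.
  rcases le_total (1 - η) 0 with hη1 | hη1
  · refine le_trans ?_ (by positivity : 0 ≤ C.worstError ε₁ ε₂ + (A + 1 + S) * K * c * q)
    rw [mul_assoc]
    exact mul_nonpos_of_nonpos_of_nonneg hη1 (by positivity)
  have hPX : P / X ≤ A + 1 + S := by
    rw [div_le_iff₀ hpos]
    have e1 : 0 ≤ ε₁ * N * (1 + S) := by positivity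
    have e2 : 0 ≤ ε₂ * (M * (A + 1) + A + S) := by positivity
    simp only [P, X]
    push_cast
    linarith
  -- Since `c < 1 + η`, this is `(1 - η) * (1 + η) ≤ 1`.
  have hηc : (1 - η) * c ≤ 1 := by
    have := mul_le_mul_of_nonneg_left hlt.le hη1
    nlinarith [sq_nonneg η]
  have hPs : P / s ≤ C.worstError ε₁ ε₂ := by
    rw [div_le_iff₀ hs0]
    exact hC ε₁ ε₂ h₁ h₂
  calc (1 - η) * (P / X) * T.worstError ε₁ ε₂
      ≤ (1 - η) * (P / X) * ((X + K * q) * (c / s)) :=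
        mul_le_mul_of_nonneg_left (hT ε₁ ε₂ h₁ h₁' h₂ h₂') (by positivity)
    _ = (1 - η) * c * (P / s) + (1 - η) * ((P / X) * K * (c / s) * q) := by
        field_simp
    _ ≤ 1 * C.worstError ε₁ ε₂ + 1 * ((A + 1 + S) * K * c * q) := by
        refine add_le_add (mul_le_mul hηc hPs (by positivity) zero_le_one) ?_
        refine mul_le_mul (by linarith) ?_ (by positivity) zero_le_one
        gcongr
        exact div_le_self hc hs
    _ = _ := by ring

theorem mainTheorem10 {𝕜 : Type*} [RCLike 𝕜] (m n D : ℕ) (hm : 1 ≤ m) (hn : 1 ≤ n) (hD : 1 ≤ D) :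
    (∃ K : ℝ, ∀ (d : Fin m → Fin n → ℕ) (T C : PEPS 𝕜 m n d),
      T.tensor ≠ 0 → C.IsCanonical → C.tensor = T.tensor → C.BondsLE D →
      ∀ ε₁ ε₂ : ℝ, 0 ≤ ε₁ → ε₁ ≤ 1 → 0 ≤ ε₂ → ε₂ ≤ 1 →
        0 < ε₁ * ((n : ℝ) - 1) + ε₂ * (m : ℝ) →
        BddAbove (C.errorSet ε₁ ε₂) ∧ BddAbove (T.errorSet ε₁ ε₂) ∧
        C.worstError ε₁ ε₂ ≤
          (ε₁ * (((n : ℝ) - 1) * (D : ℝ) ^ ((m : ℝ) / 2)) +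
              ε₂ * (1 + ((m : ℝ) - 1) * Real.sqrt (D : ℝ))) /
            (ε₁ * ((n : ℝ) - 1) + ε₂ * (m : ℝ)) * T.worstError ε₁ ε₂
          + K * (ε₁ ^ 2 + ε₂ ^ 2)) ∧
    (∀ d : ℕ, D ≤ d → ∀ η : ℝ, 0 < η →
      ∃ T C : PEPS 𝕜 m n (fun _ _ => d),
        T.tensor ≠ 0 ∧ C.IsCanonical ∧ C.tensor = T.tensor ∧
        T.BondsEq D ∧ C.BondsEq D ∧ T.HasFullRank ∧
        ∃ K : ℝ, ∀ ε₁ ε₂ : ℝ, 0 ≤ ε₁ → ε₁ ≤ 1 → 0 ≤ ε₂ → ε₂ ≤ 1 →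
          0 < ε₁ * ((n : ℝ) - 1) + ε₂ * (m : ℝ) →
          (1 - η) *
            ((ε₁ * (((n : ℝ) - 1) * (D : ℝ) ^ ((m : ℝ) / 2)) +
                ε₂ * (1 + ((m : ℝ) - 1) * Real.sqrt (D : ℝ))) /
              (ε₁ * ((n : ℝ) - 1) + ε₂ * (m : ℝ))) * T.worstError ε₁ ε₂ ≤
            C.worstError ε₁ ε₂ + K * (ε₁ ^ 2 + ε₂ ^ 2)) := by
  obtain ⟨M, rfl⟩ : ∃ M, m = M + 1 := ⟨m - 1, by omega⟩
  obtain ⟨N, rfl⟩ : ∃ N, n = N + 1 := ⟨n - 1, by omega⟩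
  have hsub : ∀ k : ℕ, ((k + 1 : ℕ) : ℝ) - 1 = k := fun k => by push_cast; ring
  simp only [hsub]
  constructor
  · obtain ⟨K, hK⟩ := PEPS.exists_worstError_canonical_le (𝕜 := 𝕜) M N D
    exact ⟨K, fun d T C hT hC hCT hD ε₁ ε₂ h₁ h₁' h₂ h₂' hpos =>
      ⟨C.bddAbove_errorSet ε₁ ε₂, T.bddAbove_errorSet ε₁ ε₂,
        hK d T C hT hC hCT hD ε₁ ε₂ h₁ h₁' h₂ h₂' hpos⟩⟩
  · exact fun d hd η hη => exists_worstError_canonical_ge M N D d hD hd hη
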